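/- Let $k$ be a field with the discrete topology, and let $\mathbf{Vect}_0(k)$ be the category of finite-dimensional $k$-vector spaces. Let $\Pi=\{(i,j)\in\mathbb Z^2: i\le j\}$ with the product order. A functor $V:\Pi\to\mathbf{Vect}_0(k)$ is *admissible* if $0\to V_{ij}\to V_{il}\to V_{jl}\to 0$ is exact for all $i\le j\le l$. The category of Tate spaces $\mathcal T=\underleftrightarrow{\lim}\,\mathbf{Vect}_0(k)$ is the localization of the category of admissible functors at the natural morphisms $(V_{\varphi_0(i),\varphi_0(j)})\to (V_{\varphi_1(i),\varphi_1(j)})$, where $\varphi_0\le\varphi_1$ are nondecreasing maps $\mathbb Z\to\mathbb Z$ tending to $\pm\infty$ at $\pm\infty$. A linearly topologized $k$-vector space is a Hausdorff topological $k$-vector space in which the open linear subspaces form a basis of neighbourhoods of $0$. It is *linearly compact* if every family of closed affine subspaces with the finite intersection property has a common point, and *locally linearly compact* if it has an open linearly compact subspace. A locally linearly compact space is *of countable type* if $0$ has a countable neighbourhood basis and the space is a union of countably many open linearly compact subspaces. Morphisms of such spaces are the continuous linear maps. Limits and colimits below are taken in topological $k$-vector spaces, finite-dimensional spaces being discrete.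 Then: 1. $(V_{ij})\mapsto \varinjlim_{j\to\infty}\varprojlim_{i\to-\infty}V_{ij}$ induces an equivalence $\Phi$ from $\mathcal T$ to the category of locally linearly compact topological $k$-vector spaces of countable type. 2. The projective limit $``\varprojlim"V_j\mapsto\varprojlim V_j$ induces an equivalence $\Phi_0$ from the category $\mathrm{Pro}^s(\mathbf{Vect}_0(k))$ of strict pro-objects (those represented by a system, indexed by an arbitrary small filtered category, with epimorphic structure morphisms) to the category of linearly compact topological $k$-vector spaces. 3. Let $\mathrm{Pro}^s_{\aleph_0}(\mathbf{Vect}_0(k))\subset \mathrm{Pro}^s(\mathbf{Vect}_0(k))$ be the full subcategory of the strict pro-objects represented by such systems indexed by countable filtered categories. There is a fully faithful functor $E:\mathrm{Pro}^s_{\aleph_0}(\mathbf{Vect}_0(k))\to\mathcal T$ which sends $``\varprojlim"_{i\le 0}V_{i,0}$ to $(V_{ij})$, naturally in $(V_{ij})$, for every admissible $(V_{ij})$ such that $V_{i,0}\to V_{i,j}$ is an isomorphism for all $i\le 0\le j$; the restriction $\Phi\circ E$ of $\Phi$ is isomorphic to the restriction of $\Phi_0$, and its essential image consists of the linearly compact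 spaces of countable type. -/

import Mathlib

open CategoryTheory Limits Opposite Topology

universe v u

/-! ### Pro-objects -/

section ProObjects

variable (C : Type u) [Category.{v} C]

/-- The category of pro-objects of `C`, i.e. `Pro(C) = Ind(Cᵒᵖ)ᵒᵖ`. -/
abbrev ProObj : Type (max u (v + 1)) := (Ind Cᵒᵖ)ᵒᵖ

/-- The embedding `C ⥤ Pro(C)` (constant pro-objects). -/
noncomputable def ProObj.const : C ⥤ ProObj C :=
  opOp C ⋙ (Ind.yoneda (C := Cᵒᵖ)).op

/-- The functor `F ↦ "lim" F_j` from projective systems indexed by a small filtered category `J`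
to pro-objects. -/
noncomputable def ProObj.lim (J : Type v) [SmallCategory J] [IsFiltered J] :
    (Jᵒᵖ ⥤ C) ⥤ ProObj C :=
  (Functor.leftOpRightOpEquiv J C).functor.rightOp ⋙ (Ind.lim J).op

variable {C} in
/-- The canonical cone from the pro-object `"lim" F_j` to the constant pro-objects `F_j`. -/
noncomputable def ProObj.cone {J : Type v} [SmallCategory J] [IsFiltered J] (F : Jᵒᵖ ⥤ C) :
    Cone (F ⋙ ProObj.const C) where
  pt := (ProObj.lim C J).obj F
  π := (colimit.cocone (F.rightOp ⋙ Ind.yoneda)).op.π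

/-- Strict pro-objects: those isomorphic to some `"lim" F_j`, with `J` a small filtered category,
whose structure morphisms are epimorphisms. -/
def IsStrictPro : ObjectProperty (ProObj C) := fun X =>
  ∃ (J : Type v) (_ : SmallCategory J) (_ : IsFiltered J) (F : Jᵒᵖ ⥤ C),
    (∀ (a b : Jᵒᵖ) (f : a ⟶ b), Epi (F.map f)) ∧ Nonempty (X ≅ (ProObj.lim C J).obj F)

/-- Countable strict pro-objects: those isomorphic to some `"lim" F_j`, with `J` a countable
filtered category, whose structure morphisms are epimorphisms. -/
def IsCountableStrictPro : ObjectProperty (ProObj C) := fun X =>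
  ∃ (J : Type v) (_ : SmallCategory J) (_ : IsFiltered J) (_ : CountableCategory J)
    (F : Jᵒᵖ ⥤ C),
    (∀ (a b : Jᵒᵖ) (f : a ⟶ b), Epi (F.map f)) ∧ Nonempty (X ≅ (ProObj.lim C J).obj F)

theorem isCountableStrictPro_le : IsCountableStrictPro C ≤ IsStrictPro C := by
  rintro X ⟨J, i₁, i₂, _, F, hF, e⟩
  exact ⟨J, i₁, i₂, F, hF, e⟩

end ProObjects

/-! ### The Beilinson category -/

section Beilinson

/-- The ordered set `Π = {(i, j) ∈ ℤ × ℤ | i ≤ j}`, with the order induced from `ℤ × ℤ`. -/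
abbrev TateIdx : Type := {p : ℤ × ℤ // p.1 ≤ p.2}

/-- The element `(i, j)` of `Π`. -/
abbrev TateIdx.mk (i j : ℤ) (h : i ≤ j) : TateIdx := ⟨(i, j), h⟩

/-- The morphism `(i, j) ⟶ (i', j')` of `Π` for `i ≤ i'` and `j ≤ j'`. -/
noncomputable def TateIdx.hom {i j i' j' : ℤ} (h : i ≤ j) (h' : i' ≤ j') (hi : i ≤ i') (hj : j ≤ j') :
    TateIdx.mk i j h ⟶ TateIdx.mk i' j' h' :=
  homOfLE (show TateIdx.mk i j h ≤ TateIdx.mk i' j' h' from ⟨hi, hj⟩)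

variable (A : Type u) [Category.{v} A] [HasZeroMorphisms A]

/-- A functor `X : Π ⥤ A` is admissible if `0 → X_{ij} → X_{ik} → X_{jk} → 0` is a short exact
sequence for all `i ≤ j ≤ k`. -/
def IsAdmissibleBiFun : ObjectProperty (TateIdx ⥤ A) := fun X =>
  ∀ (i j k : ℤ) (hij : i ≤ j) (hjk : j ≤ k),
    ∃ w : X.map (TateIdx.hom hij (hij.trans hjk) le_rfl hjk) ≫
        X.map (TateIdx.hom (hij.trans hjk) hjk hij le_rfl) = 0,
      (ShortComplex.mk _ _ w).ShortExact

/-- The category of admissible functors `Π ⥤ A`. -/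
abbrev AdmBiFun := (IsAdmissibleBiFun A).FullSubcategory

/-- A nondecreasing map `φ : ℤ → ℤ` is bicofinal if `φ → ±∞` at `±∞`. -/
structure Bicofinal extends ℤ →o ℤ where
  tendsto_atBot : Filter.Tendsto toFun Filter.atBot Filter.atBot
  tendsto_atTop : Filter.Tendsto toFun Filter.atTop Filter.atTop

/-- The endofunctor `(i, j) ↦ (φ i, φ j)` of `Π`. -/
noncomputable def Bicofinal.tilde (φ : Bicofinal) : TateIdx ⥤ TateIdx :=
  Monotone.functor (f := fun p => TateIdx.mk (φ.toFun p.1.1) (φ.toFun p.1.2) (φ.monotone' p.2))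
    (fun _ _ h => ⟨φ.monotone' h.1, φ.monotone' h.2⟩)

variable {A}

/-- The admissible functor `X ∘ φ̃`, i.e. `(i, j) ↦ X_{φ i, φ j}`. -/
noncomputable def AdmBiFun.reindex (X : AdmBiFun A) (φ : Bicofinal) : AdmBiFun A :=
  ⟨φ.tilde ⋙ X.obj, fun i j k hij hjk =>
    X.property (φ.toFun i) (φ.toFun j) (φ.toFun k) (φ.monotone' hij) (φ.monotone' hjk)⟩

/-- For `φ₀ ≤ φ₁`, the morphism `X ∘ φ̃₀ ⟶ X ∘ φ̃₁` given by the structure morphisms of `X`. -/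
noncomputable def AdmBiFun.reindexHom (X : AdmBiFun A) {φ₀ φ₁ : Bicofinal}
    (h : ∀ n, φ₀.toFun n ≤ φ₁.toFun n) : X.reindex φ₀ ⟶ X.reindex φ₁ :=
  ObjectProperty.homMk
    { app := fun p => X.obj.map (TateIdx.hom (φ₀.monotone' p.2) (φ₁.monotone' p.2)
        (h p.1.1) (h p.1.2))
      naturality := fun p _ f =>
        (X.obj.map_comp _ _).symm.trans
          (X.obj.map_comp (TateIdx.hom (φ₀.monotone' p.2) (φ₁.monotone' p.2)
            (h p.1.1) (h p.1.2)) (φ₁.tilde.map f)) }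

variable (A)

/-- The class `U_a` of the morphisms `X ∘ φ̃₀ ⟶ X ∘ φ̃₁`, for `X` an admissible functor and
`φ₀ ≤ φ₁` bicofinal. -/
inductive BeilinsonU : ∀ ⦃X Y : AdmBiFun A⦄, (X ⟶ Y) → Prop
  | mk (X : AdmBiFun A) (φ₀ φ₁ : Bicofinal) (h : ∀ n, φ₀.toFun n ≤ φ₁.toFun n) :
      BeilinsonU (X.reindexHom h)

/-- `U_a` as a class of morphisms in the sense of localization theory. -/
def beilinsonU : MorphismProperty (AdmBiFun A) := fun _ _ f => BeilinsonU A f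

/-- The Beilinson category `lim↔ A`: the localization of the category of admissible functors
`Π ⥤ A` at `U_a`. -/
abbrev BeilinsonCat := (beilinsonU A).Localization

/-- An admissible functor `X` is constant in the ind-direction if `X_{i,0} → X_{i,j}` is an
isomorphism for all `i ≤ 0 ≤ j`. -/
def IsIndConstant : ObjectProperty (AdmBiFun A) := fun X =>
  ∀ (i j : ℤ) (hi : i ≤ 0) (hj : 0 ≤ j),
    IsIso (X.obj.map (TateIdx.hom hi (hi.trans hj) le_rfl hj))

/-- The functor `n ↦ (-n, 0)` from `ℕᵒᵖ` to `Π` (with `ℕ` lifted to the universe of the index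
categories of pro-objects). -/
noncomputable def negIdx : (ULift.{v} ℕ)ᵒᵖ ⥤ TateIdx where
  obj n := TateIdx.mk (-(n.unop.down : ℤ)) 0 (by simp)
  map f := TateIdx.hom _ _ (neg_le_neg (Int.ofNat_le.mpr (ULift.down_le.mpr (leOfHom f.unop))))
    le_rfl

/-- The functor sending an admissible functor `X` that is constant in the ind-direction to the
countable strict pro-object `"lim"_{i ≤ 0} X_{i,0}`. -/
noncomputable def indConstantToPro :
    (IsIndConstant A).FullSubcategory ⥤ (IsCountableStrictPro A).FullSubcategory :=
  ObjectProperty.lift _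
    ((IsIndConstant A).ι ⋙ (IsAdmissibleBiFun A).ι ⋙
      (Functor.whiskeringLeft _ _ A).obj negIdx.{v} ⋙ ProObj.lim A (ULift.{v} ℕ))
    (fun X => ⟨ULift.{v} ℕ, inferInstance, inferInstance, inferInstance,
      negIdx.{v} ⋙ X.obj.obj, fun a b f => by
        obtain ⟨w, hw⟩ := X.obj.property (-(a.unop.down : ℤ)) (-(b.unop.down : ℤ)) 0
          (neg_le_neg (Int.ofNat_le.mpr (ULift.down_le.mpr (leOfHom f.unop)))) (by simp)
        exact hw.epi_g,
      ⟨Iso.refl _⟩⟩)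

end Beilinson

/-! ### Linearly compact and locally linearly compact spaces -/

section LinearTopology

variable (k V : Type*) [Field k] [AddCommGroup V] [Module k V] [TopologicalSpace V]

/-- `V` is a (Hausdorff) linearly topologized space in which every family of closed affine
subspaces with the finite intersection property has a common point. -/
structure IsLinearlyCompact : Prop where
  t2 : T2Space V
  linear : IsLinearTopology k V
  inter_nonempty : ∀ 𝓕 : Set (AffineSubspace k V), (∀ L ∈ 𝓕, IsClosed (L : Set V)) →
    (∀ 𝓖 : Finset (AffineSubspace k V), (𝓖 : Set (AffineSubspace k V)) ⊆ 𝓕 →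
      (⋂ L ∈ 𝓖, (L : Set V)).Nonempty) →
    (⋂ L ∈ 𝓕, (L : Set V)).Nonempty

/-- `V` is a (Hausdorff) linearly topologized space with a linearly compact open subspace. -/
structure IsLocallyLinearlyCompact : Prop where
  t2 : T2Space V
  linear : IsLinearTopology k V
  exists_open : ∃ U : Submodule k V, IsOpen (U : Set V) ∧ IsLinearlyCompact k U

/-- `V` is of countable type: `0` has a countable neighbourhood basis, and `V` is a union of
countably many linearly compact open subspaces. -/
structure IsOfCountableType : Prop where
  countable_nhds : (𝓝 (0 : V)).IsCountablyGenerated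
  exists_cover : ∃ U : ℕ → Submodule k V,
    (∀ n, IsOpen (U n : Set V) ∧ IsLinearlyCompact k (U n)) ∧ ∀ x : V, ∃ n, x ∈ U n

end LinearTopology

section Spaces

variable (k : Type u) [Field k] [TopologicalSpace k]

/-- Linearly compact topological `k`-vector spaces. -/
def linearlyCompactProp : ObjectProperty (TopModuleCat.{u} k) := fun V => IsLinearlyCompact k V

/-- Locally linearly compact topological `k`-vector spaces of countable type. -/
def countableLLCProp : ObjectProperty (TopModuleCat.{u} k) := fun V =>
  IsLocallyLinearlyCompact k V ∧ IsOfCountableType k V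

/-- The category `𝓛₀` of linearly compact spaces and continuous linear maps. -/
abbrev LinearlyCompactCat := (linearlyCompactProp k).FullSubcategory

/-- The category of locally linearly compact spaces of countable type and continuous linear
maps. -/
abbrev CountableLLCCat := (countableLLCProp k).FullSubcategory

variable [DiscreteTopology k]

/-- A finite-dimensional vector space, equipped with the discrete topology. -/
def discreteFunctor : FGModuleCat.{u} k ⥤ TopModuleCat.{u} k where
  obj V :=
    letI : TopologicalSpace V := ⊥
    haveI : DiscreteTopology V := ⟨rfl⟩
    haveI : ContinuousSMul k V := ⟨continuous_of_discreteTopology⟩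
    TopModuleCat.of k V
  map {V W} f :=
    letI : TopologicalSpace V := ⊥
    haveI : DiscreteTopology V := ⟨rfl⟩
    letI : TopologicalSpace W := ⊥
    haveI : DiscreteTopology W := ⟨rfl⟩
    haveI : ContinuousSMul k V := ⟨continuous_of_discreteTopology⟩
    haveI : ContinuousSMul k W := ⟨continuous_of_discreteTopology⟩
    TopModuleCat.ofHom ⟨f.hom.hom, continuous_of_discreteTopology⟩

/-- `Λ : Pro(Vect₀(k)) ⥤ TopModuleCat k` is the projective limit functor
`"lim" F_j ↦ lim F_j`, where finite-dimensional spaces are discrete: there is an isomorphism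
`β` between its restriction to `Vect₀(k)` and `discreteFunctor k`, and for each projective system
`F` the projections `Λ("lim" F_j) ⟶ Λ(F_j) ≅ F_j` exhibit `Λ("lim" F_j)` as the limit of the
topological vector spaces `F_j`. -/
def IsProjectiveLimitFunctor (Λ : ProObj (FGModuleCat.{u} k) ⥤ TopModuleCat.{u} k) : Prop :=
  ∃ β : ProObj.const (FGModuleCat.{u} k) ⋙ Λ ≅ discreteFunctor k,
    ∀ (J : Type u) [SmallCategory J] [IsFiltered J] (F : Jᵒᵖ ⥤ FGModuleCat.{u} k),
      Nonempty (IsLimit ((Cone.postcompose (Functor.whiskerLeft F β.hom)).obj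
        (Λ.mapCone (ProObj.cone F))))

/-- The functor `j ↦ (i ↦ (min i j, j))`. A functor `X` on `Π` is extended along it to a functor
on `ℤ × ℤ`, by `X_{i,j} = X_{j,j}` for `i > j`. -/
noncomputable def extendIdx : ℤ ⥤ ℤ ⥤ TateIdx where
  obj j := Monotone.functor (f := fun i => TateIdx.mk (min i j) j (min_le_right i j))
    (fun _ _ h => ⟨min_le_min_right j h, le_rfl⟩)
  map {j j'} h :=
    { app := fun i => TateIdx.hom _ _ (min_le_min_left i (leOfHom h)) (leOfHom h) }

/-- The functor `X ↦ colim_j lim_i X_{ij}` from functors `Π ⥤ Vect₀(k)` to topological vector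
spaces: the limit over `i → -∞` and the colimit over `j → ∞` are taken in the category of
topological vector spaces, the finite-dimensional spaces `X_{ij}` being discrete. -/
noncomputable def indProLim : (TateIdx ⥤ FGModuleCat.{u} k) ⥤ TopModuleCat.{u} k :=
  (Functor.whiskeringRight _ _ _).obj (discreteFunctor k) ⋙
    Functor.whiskeringRight ℤ TateIdx (TopModuleCat.{u} k) ⋙
    (Functor.whiskeringLeft ℤ (ℤ ⥤ TateIdx) (ℤ ⥤ TopModuleCat.{u} k)).obj extendIdx ⋙
    (Functor.whiskeringRight ℤ (ℤ ⥤ TopModuleCat.{u} k) (TopModuleCat.{u} k)).obj lim ⋙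
    colim

/-- The category `𝓣 = lim↔ Vect₀(k)` of Tate vector spaces over `k`. -/
abbrev TateCat (k : Type u) [Field k] := BeilinsonCat (FGModuleCat.{u} k)

/-- The category `Pro^s(Vect₀(k))` of strict pro-finite-dimensional spaces. -/
abbrev StrictProVect (k : Type u) [Field k] := (IsStrictPro (FGModuleCat.{u} k)).FullSubcategory

/-- The category of countable strict pro-finite-dimensional spaces. -/
abbrev CountableStrictProVect (k : Type u) [Field k] :=
  (IsCountableStrictPro (FGModuleCat.{u} k)).FullSubcategory

end Spaces

-- A locally linearly compact space of countable type is the same thing as a space with a filtration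
-- by open subspaces `L j`, for integers `j`, that is separated, complete and exhaustive, is a
-- neighbourhood basis of zero as `j → -∞`, and has finite-dimensional subquotients. The
-- subquotients `L j / L i` form an admissible functor, and the space with its filtration can be
-- recovered from them. `TateRealization` records this relation. Its main properties are that
-- natural transformations correspond to the continuous maps respecting the filtrations
-- (`exists_compat`, `exists_hom_compat`, `Compat.unique`), that `colim lim` carries a canonical
-- realization (`indProLim.realization`), and that every space of the target category has one
-- (`exists_tateRealization`).
--
-- A general continuous map need not respect the filtrations, but it does after the source is
-- reindexed by some `φ ≤ id` (`exists_bicofinal`). Small subspaces go to small ones by continuity,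
-- and each `L j` lands in some step of the target because it is finite-dimensional modulo a
-- subspace that already does. Morphisms of the localization are fractions with exactly such
-- denominators `X ∘ φ̃ ⟶ X` (`AdmBiFun.isRoof`), so `Φ` is fully faithful.
--
-- For pro-objects, the limit functor is the pointwise right Kan extension of the discrete
-- embedding. On a strict system the projections from the limit are surjective
-- (`FGModuleCat.exists_section_of_surjective`, a linear compactness argument), and a continuous map
-- to a discrete space factors through one stage because its kernel is open; full faithfulness
-- follows. A linearly compact space is the limit of its quotients by open subspaces, which are
-- finite-dimensional (`finite_quotient`).
--
-- Finally `E` is the countable part of `Φ₀` followed by an inverse of `Φ`. Its value on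
-- ind-constant functors is found by comparing two limit cones over the `X_{-n,0}`
-- (`indConstantNatIso`).

universe w w'

/-! ### Linear compactness and finite-dimensional quotients -/

section LinearCompactness

variable {k : Type*} [Field k]

/-- A member whose direction has least dimension lies in all the others: a common refinement of it
and another member has the same direction, hence equals it. -/
theorem AffineSubspace.exists_mem_of_directed {E : Type*} [AddCommGroup E] [Module k E]
    [Module.Finite k E] {I : Type*} [Nonempty I] (L : I → AffineSubspace k E)
    (hL : Directed (· ≥ ·) L) (hne : ∀ i, (L i : Set E).Nonempty) : ∃ x, ∀ i, x ∈ L i := by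
  obtain ⟨i, hi⟩ : ∃ i, ∀ j, Module.finrank k (L i).direction ≤ Module.finrank k (L j).direction :=
    ⟨_, fun j => Function.argmin_le (fun i => Module.finrank k (L i).direction) j⟩
  obtain ⟨x, hx⟩ := hne i
  refine ⟨x, fun j => ?_⟩
  obtain ⟨m, hmi, hmj⟩ := hL i j
  have h1 : (L m).direction = (L i).direction :=
    Submodule.eq_of_le_of_finrank_le (AffineSubspace.direction_le hmi) (hi m)
  have h2 : L m = L i := AffineSubspace.eq_of_direction_eq_of_nonempty_of_le h1 (hne m) hmi
  exact hmj (h2 ▸ hx)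

variable {V : Type*} [AddCommGroup V] [Module k V]

/-- A family of linear maps to finite-dimensional spaces through which every finitely consistent
family of values factors has the property that each family of affine subspaces with the finite
intersection property has a common adherent point. -/
theorem AffineSubspace.exists_forall_adherent {A : Type*} {E : A → Type*}
    [∀ a, AddCommGroup (E a)] [∀ a, Module k (E a)] [∀ a, Module.Finite k (E a)]
    (p : ∀ a, V →ₗ[k] E a)
    (hp : ∀ e : ∀ a, E a, (∀ S : Finset A, ∃ y, ∀ a ∈ S, p a y = e a) → ∃ x, ∀ a, p a x = e a)
    (F : Set (AffineSubspace k V)) (hF : ∀ G ⊆ F, G.Finite → ∃ x, ∀ L ∈ G, x ∈ L) :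
    ∃ x, ∀ L ∈ F, ∀ S : Finset A, ∃ y ∈ L, ∀ a ∈ S, p a y = p a x := by
  classical
  -- As with ultrafilters, `F` is enlarged to a maximal family `M` with the finite intersection
  -- property; maximality then admits every affine subspace that meets all finite intersections of
  -- members.
  let 𝓒 : Set (Set (AffineSubspace k V)) := {M | ∀ G ⊆ M, G.Finite → ∃ x, ∀ L ∈ G, x ∈ L}
  have h𝓒 : Order.IsOfFiniteCharacter 𝓒 := fun M =>
    ⟨fun hM G hG _ G' hG' hf => hM G' (hG'.trans hG) hf, fun h G hG hf => h G hG hf G subset_rfl hf⟩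
  obtain ⟨M, hFM, hM⟩ := h𝓒.exists_maximal (x := F) hF
  have hadd : ∀ K : AffineSubspace k V,
      (∀ G ⊆ M, G.Finite → ∃ x ∈ K, ∀ L ∈ G, x ∈ L) → K ∈ M := by
    intro K hK
    refine hM.2 (y := insert K M) ?_ (Set.subset_insert _ _) (Set.mem_insert _ _)
    intro G hG hf
    obtain ⟨x, hxK, hx⟩ := hK (G \ {K}) (by
      rintro L ⟨hL, hLK⟩
      exact (hG hL).resolve_left hLK) hf.sdiff
    refine ⟨x, fun L hL => ?_⟩
    by_cases h : L = K
    · exact h ▸ hxK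
    · exact hx L ⟨hL, h⟩
  -- The images in `E a` of the finite intersections from `M` are directed and nonempty, so they
  -- share a point `e`.
  have key : ∀ a, ∃ e : E a, ∀ G ⊆ M, G.Finite → ∃ x, p a x = e ∧ ∀ L ∈ G, x ∈ L := by
    intro a
    let I := {G : Set (AffineSubspace k V) // G ⊆ M ∧ G.Finite}
    have : Nonempty I := ⟨⟨∅, Set.empty_subset _, Set.finite_empty⟩⟩
    obtain ⟨e, he⟩ := AffineSubspace.exists_mem_of_directed (k := k) (I := I)
      (fun G => (sInf G.1).map (p a).toAffineMap) (fun G G' =>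
        ⟨⟨G.1 ∪ G'.1, Set.union_subset G.2.1 G'.2.1, G.2.2.union G'.2.2⟩,
          AffineSubspace.map_mono _ (sInf_le_sInf Set.subset_union_left),
          AffineSubspace.map_mono _ (sInf_le_sInf Set.subset_union_right)⟩) (fun G => by
        obtain ⟨x, hx⟩ := hM.1 G.1 G.2.1 G.2.2
        exact ⟨p a x, x, by simpa [AffineSubspace.mem_sInf_iff] using hx, rfl⟩)
    refine ⟨e, fun G hG hf => ?_⟩
    obtain ⟨x, hx, rfl⟩ := he ⟨G, hG, hf⟩
    refine ⟨x, rfl, fun L hL => ?_⟩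
    exact (sInf_le hL : sInf G ≤ L) hx
  choose e he using key
  -- The fibres over the points `e a` belong to `M`. Hence finitely many of them meet, which is the
  -- consistency required by `hp`, and they still meet inside any given `L`, which is the adherence.
  let fib : ∀ a, AffineSubspace k V := fun a =>
    (AffineSubspace.mk' (e a) (⊥ : Submodule k (E a))).comap (p a).toAffineMap
  have hfib : ∀ a x, x ∈ fib a ↔ p a x = e a := by
    intro a x
    simp [fib, AffineSubspace.mem_mk', sub_eq_zero]
  have hfM : ∀ a, fib a ∈ M := fun a => hadd _ fun G hG hf => by
    obtain ⟨x, hx, h⟩ := he a G hG hf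
    exact ⟨x, (hfib a x).2 hx, h⟩
  obtain ⟨x, hx⟩ := hp e fun S => by
    obtain ⟨y, hy⟩ := hM.1 (fib '' S) (by rintro _ ⟨a, -, rfl⟩; exact hfM a) (S.finite_toSet.image _)
    exact ⟨y, fun a ha => (hfib a y).1 (hy _ ⟨a, ha, rfl⟩)⟩
  refine ⟨x, fun L hL S => ?_⟩
  obtain ⟨y, hy⟩ := hM.1 (insert L (fib '' S)) (Set.insert_subset (hFM hL)
    (by rintro _ ⟨a, -, rfl⟩; exact hfM a)) ((S.finite_toSet.image _).insert _)
  exact ⟨y, hy L (Set.mem_insert _ _), fun a ha =>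
    ((hfib a y).1 (hy _ (Set.mem_insert_of_mem _ ⟨a, ha, rfl⟩))).trans (hx a).symm⟩

variable [TopologicalSpace V]

/-- A topological vector space which is the limit of a family of finite-dimensional discrete spaces
is linearly compact. -/
theorem IsLinearlyCompact.of_family [IsTopologicalAddGroup V] {A : Type*} {E : A → Type*}
    [∀ a, AddCommGroup (E a)] [∀ a, Module k (E a)] [∀ a, Module.Finite k (E a)]
    (p : ∀ a, V →ₗ[k] E a) (hopen : ∀ a, IsOpen ((p a).ker : Set V))
    (hbasis : ∀ U ∈ 𝓝 (0 : V), ∃ S : Finset A, ∀ y, (∀ a ∈ S, p a y = 0) → y ∈ U)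
    (hinj : ∀ x, (∀ a, p a x = 0) → x = 0)
    (hp : ∀ e : ∀ a, E a, (∀ S : Finset A, ∃ y, ∀ a ∈ S, p a y = e a) → ∃ x, ∀ a, p a x = e a) :
    IsLinearlyCompact k V := by
  have hS : ∀ S : Finset A, IsOpen ((⨅ a ∈ S, (p a).ker : Submodule k V) : Set V) := by
    intro S
    simp only [Submodule.coe_iInf]
    exact isOpen_biInter_finset fun a _ => hopen a
  refine ⟨?_, ?_, ?_⟩
  · rw [IsTopologicalAddGroup.t2Space_iff_zero_closed, ← isOpen_compl_iff, isOpen_iff_mem_nhds]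
    intro x hx
    obtain ⟨a, ha⟩ : ∃ a, p a x ≠ 0 := by
      by_contra! h
      exact hx (hinj x h)
    have : (fun y => y - x) ⁻¹' ((p a).ker : Set V) ∈ 𝓝 x :=
      ((hopen a).preimage (continuous_id.sub continuous_const)).mem_nhds (by simp)
    filter_upwards [this] with y hy hy0
    rw [Set.mem_singleton_iff] at hy0
    subst hy0
    exact ha (by simpa using hy)
  · refine IsLinearTopology.mk_of_hasBasis (S := Submodule k V) (ι := Finset A) (p := fun _ => True)
      (s := fun S => ⨅ a ∈ S, (p a).ker) k ⟨fun U => ⟨fun hU => ?_, ?_⟩⟩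
    · obtain ⟨S, hS⟩ := hbasis U hU
      exact ⟨S, trivial, fun y hy => hS y (by simpa using hy)⟩
    · rintro ⟨S, -, h⟩
      exact Filter.mem_of_superset ((hS S).mem_nhds (zero_mem _)) h
  · intro 𝓕 hcl hfip
    obtain ⟨x, hx⟩ := AffineSubspace.exists_forall_adherent p hp 𝓕 fun G hG hf => by
      obtain ⟨x, hx⟩ := hfip hf.toFinset (by simpa using hG)
      exact ⟨x, by simpa using hx⟩
    refine ⟨x, Set.mem_iInter₂.2 fun L hL => ?_⟩
    rw [← (hcl L hL).closure_eq, mem_closure_iff_nhds_zero]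
    intro U hU
    obtain ⟨S, hS⟩ := hbasis U hU
    obtain ⟨y, hy, h⟩ := hx L hL S
    exact ⟨y, hy, hS _ fun a ha => by simp [h a ha]⟩

theorem IsLinearlyCompact.exists_forall_mem (hV : IsLinearlyCompact k V) {I : Type*}
    (L : I → AffineSubspace k V) (hL : ∀ i, IsClosed (L i : Set V))
    (hne : ∀ S : Finset I, ∃ x, ∀ i ∈ S, x ∈ L i) : ∃ x, ∀ i, x ∈ L i := by
  classical
  obtain ⟨x, hx⟩ := hV.inter_nonempty (Set.range L) (by rintro _ ⟨i, rfl⟩; exact hL i) (by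
    intro G hG
    rw [← Set.image_univ, Finset.subset_set_image_iff] at hG
    obtain ⟨S, -, rfl⟩ := hG
    obtain ⟨x, hx⟩ := hne S
    exact ⟨x, by simpa using hx⟩)
  exact ⟨x, by simpa using hx⟩

/-- The complement is also stable under translation by `U`, hence a union of open cosets. -/
theorem IsOpen.isClosed_of_add_mem [IsTopologicalAddGroup V] {U : Submodule k V}
    (hU : IsOpen (U : Set V)) {s : Set V} (hs : ∀ x ∈ s, ∀ u ∈ U, x + u ∈ s) : IsClosed s := by
  rw [← isOpen_compl_iff, isOpen_iff_mem_nhds]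
  intro x hx
  have : (fun y => x - y) ⁻¹' (U : Set V) ∈ 𝓝 x :=
    (hU.preimage (continuous_const.sub continuous_id)).mem_nhds (by simp)
  filter_upwards [this] with y hy hys
  exact hx (by simpa using hs y hys (x - y) hy)

/-- Cosets of open subspaces are closed. This is the form in which linear compactness yields
completeness of filtrations and of quotient systems. -/
theorem IsLinearlyCompact.exists_sub_mem [IsTopologicalAddGroup V] (hV : IsLinearlyCompact k V)
    {I : Type*} (U : I → Submodule k V) (hU : ∀ i, IsOpen (U i : Set V)) (v : I → V)
    (hne : ∀ S : Finset I, ∃ x, ∀ i ∈ S, x - v i ∈ U i) : ∃ x, ∀ i, x - v i ∈ U i := by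
  have := hV.exists_forall_mem (fun i => AffineSubspace.mk' (v i) (U i)) (fun i =>
    (hU i).isClosed_of_add_mem fun x hx u hu => by
      simp only [SetLike.mem_coe, AffineSubspace.mem_mk', vsub_eq_sub] at hx ⊢
      rw [add_sub_right_comm]
      exact add_mem hx hu) (by simpa [AffineSubspace.mem_mk'] using hne)
  simpa [AffineSubspace.mem_mk'] using this

/-- For a basis of the quotient, consider the closed hyperplanes on which one coordinate equals `1`.
Finitely many meet in a lift of a sum of basis vectors, so all of them meet; a common point has
every coordinate `1`, which forces the basis to be finite. -/
theorem IsLinearlyCompact.finite_quotient [IsTopologicalAddGroup V] (hV : IsLinearlyCompact k V)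
    (U : Submodule k V) (hU : IsOpen (U : Set V)) : Module.Finite k (V ⧸ U) := by
  classical
  let b := Module.Basis.ofVectorSpace k (V ⧸ U)
  choose v hv using fun i => U.mkQ_surjective (b i)
  let L : Module.Basis.ofVectorSpaceIndex k (V ⧸ U) → AffineSubspace k V := fun i =>
    AffineSubspace.mk' (v i) (LinearMap.ker ((b.coord i).comp U.mkQ))
  have hL : ∀ i x, x ∈ L i ↔ b.repr (U.mkQ x) i = 1 := fun i x => by
    rw [AffineSubspace.mem_mk', vsub_eq_sub, LinearMap.mem_ker, LinearMap.comp_apply, map_sub, hv,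
      map_sub, Module.Basis.coord_apply, Module.Basis.coord_apply, Module.Basis.repr_self,
      Finsupp.single_eq_same, sub_eq_zero]
  obtain ⟨x, hx⟩ := hV.exists_forall_mem L (fun i => hU.isClosed_of_add_mem fun x hx u hu => by
      rw [SetLike.mem_coe, hL] at hx ⊢
      rw [map_add, (by simpa using hu : U.mkQ u = 0), add_zero, hx]) (fun S => by
    obtain ⟨x, hx⟩ := U.mkQ_surjective (∑ i ∈ S, b i)
    refine ⟨x, fun i hi => ?_⟩
    rw [hL, hx]
    simp [Finsupp.single_apply, hi])
  have : Finite (Module.Basis.ofVectorSpaceIndex k (V ⧸ U)) := by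
    refine Set.finite_univ_iff.1 ((b.repr (U.mkQ x)).support.finite_toSet.subset fun i _ => ?_)
    have := (hL i x).1 (hx i)
    rw [Finset.mem_coe, Finsupp.mem_support_iff, this]
    exact one_ne_zero
  exact Module.Finite.of_basis b

theorem IsLinearlyCompact.of_equiv {W : Type*} [AddCommGroup W] [Module k W] [TopologicalSpace W]
    (hV : IsLinearlyCompact k V) (e : V ≃L[k] W) : IsLinearlyCompact k W := by
  refine ⟨?_, ?_, fun 𝓕 hcl hfip => ?_⟩
  · have := hV.t2
    exact e.toHomeomorph.t2Space
  · have := hV.linear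
    refine ⟨⟨fun U => ⟨fun hU => ?_, fun ⟨N, hN, h⟩ => Filter.mem_of_superset hN h⟩⟩⟩
    have h0 : e ⁻¹' U ∈ 𝓝 (0 : V) := e.continuous.continuousAt.preimage_mem_nhds (by simpa using hU)
    obtain ⟨N, hN, h⟩ := (IsLinearTopology.hasBasis_submodule k).mem_iff.1 h0
    refine ⟨N.comap e.symm.toLinearMap, ?_, fun x hx => ?_⟩
    · exact e.symm.continuous.continuousAt.preimage_mem_nhds (by simpa using hN)
    · simpa using h hx
  · obtain ⟨x, hx⟩ := hV.exists_forall_mem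
      (fun L : 𝓕 => L.1.comap e.toLinearEquiv.toLinearMap.toAffineMap)
      (fun L => (hcl L.1 L.2).preimage e.continuous) (fun S => by
        classical
        obtain ⟨x, hx⟩ := hfip (S.image Subtype.val) (by simp)
        refine ⟨e.symm x, fun L hL => ?_⟩
        have : x ∈ (L.1 : Set W) := Set.mem_iInter₂.1 hx L.1 (Finset.mem_image_of_mem _ hL)
        simpa using this)
    exact ⟨e x, Set.mem_iInter₂.2 fun L hL => hx ⟨L, hL⟩⟩

end LinearCompactness

/-- The projections from the limit of a cofiltered system of finite-dimensional spaces with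
surjective structure maps are surjective. -/
theorem FGModuleCat.exists_section_of_surjective {k : Type u} [Field k] {J : Type*} [Category* J]
    [IsCofiltered J] (G : J ⥤ FGModuleCat.{v} k)
    (hG : ∀ {a b : J} (f : a ⟶ b), Function.Surjective (G.map f).hom.hom) (j : J) (e : G.obj j) :
    ∃ x : ∀ a, G.obj a, x j = e ∧ ∀ {a b : J} (f : a ⟶ b), (G.map f).hom.hom (x a) = x b := by
  classical
  let M := Σ' (a b : J), (a ⟶ b)
  -- Inside the full product, compatibility along each arrow and the prescribed value at `j` are
  -- affine conditions, each involving at most two coordinates.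
  let C : M → AffineSubspace k (∀ a, G.obj a) := fun f =>
    (LinearMap.ker ((G.map f.2.2).hom.hom ∘ₗ LinearMap.proj (R := k) (φ := fun a => G.obj a) f.1 -
      LinearMap.proj (R := k) (φ := fun a => G.obj a) f.2.1)).toAffineSubspace
  have hC : ∀ f x, x ∈ C f ↔ (G.map f.2.2).hom.hom (x f.1) = x f.2.1 := fun f x => by
    simp [C, sub_eq_zero]
  let P : AffineSubspace k (∀ a, G.obj a) :=
    (AffineSubspace.mk' e ⊥).comap (LinearMap.proj (R := k) (φ := fun a => G.obj a) j).toAffineMap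
  have hP : ∀ x, x ∈ P ↔ x j = e := fun x => by
    simp [P, AffineSubspace.mem_mk', sub_eq_zero]
  obtain ⟨x, hx⟩ := AffineSubspace.exists_forall_adherent (k := k)
    (fun a => LinearMap.proj (R := k) (φ := fun a => G.obj a) a) (fun e _ => ⟨e, fun _ => rfl⟩)
    (insert P (Set.range C)) (by
      intro 𝓖 h𝓖 hf
      obtain ⟨T, hT⟩ : ∃ T : Finset M, ∀ L ∈ 𝓖, L = P ∨ ∃ f ∈ T, L = C f := by
        have h1 : 𝓖 \ {P} ⊆ C '' Set.univ := by
          rintro L ⟨hL, hLP⟩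
          rw [Set.image_univ]
          exact (h𝓖 hL).resolve_left hLP
        have hf1 : (𝓖 \ {P}).Finite := hf.sdiff
        obtain ⟨T, -, hT⟩ := Finset.subset_set_image_iff.1
          (show ((hf1.toFinset : Finset _) : Set _) ⊆ C '' Set.univ by simpa using h1)
        refine ⟨T, fun L hL => ?_⟩
        by_cases h : L = P
        · exact Or.inl h
        · have : L ∈ T.image C := by rw [hT]; simp [hL, h]
          obtain ⟨f, hf, rfl⟩ := Finset.mem_image.1 this
          exact Or.inr ⟨f, hf, rfl⟩
      let O : Finset J := insert j (T.image (fun f => f.1) ∪ T.image (fun f => f.2.1))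
      have ha : ∀ f ∈ T, f.1 ∈ O := fun f hf =>
        Finset.mem_insert_of_mem (Finset.mem_union_left _ (Finset.mem_image_of_mem _ hf))
      have hb : ∀ f ∈ T, f.2.1 ∈ O := fun f hf =>
        Finset.mem_insert_of_mem (Finset.mem_union_right _ (Finset.mem_image_of_mem
          (fun f : M => f.2.1) hf))
      let H : Finset (Σ' (X Y : J) (_ : X ∈ O) (_ : Y ∈ O), X ⟶ Y) :=
        T.attach.image fun f => ⟨f.1.1, f.1.2.1, ha f.1 f.2, hb f.1 f.2, f.1.2.2⟩
      obtain ⟨z, t, ht⟩ := IsCofiltered.inf_exists O H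
      obtain ⟨w, hw⟩ := hG (t (Finset.mem_insert_self j _)) e
      -- Finitely many conditions involve only the objects of `O`. They are solved by pushing one
      -- lift `w` of `e` from a common source `z`; the value outside `O` is irrelevant.
      refine ⟨fun a => if h : a ∈ O then (G.map (t h)).hom.hom w else 0, fun L hL => ?_⟩
      obtain rfl | ⟨f, hf, rfl⟩ := hT L hL
      · rw [hP, dif_pos (Finset.mem_insert_self j _), hw]
      · rw [hC, dif_pos (ha f hf), dif_pos (hb f hf),
          ← ht (ha f hf) (hb f hf) (f := f.2.2)
            (Finset.mem_image.2 ⟨⟨f, hf⟩, Finset.mem_attach _ _, rfl⟩), G.map_comp]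
        rfl)
  -- Adherence suffices, since a point agreeing with `x` in the one or two relevant coordinates
  -- satisfies the condition.
  refine ⟨x, ?_, fun {a b} f => ?_⟩
  · obtain ⟨y, hy, h⟩ := hx P (Set.mem_insert _ _) {j}
    exact (h j (by simp)).symm.trans ((hP y).1 hy)
  · obtain ⟨y, hy, h⟩ := hx (C ⟨a, b, f⟩) (Set.mem_insert_of_mem _ ⟨_, rfl⟩) {a, b}
    have h1 : y a = x a := h a (by simp)
    have h2 : y b = x b := h b (by simp)
    rw [← h1, ← h2]
    exact (hC ⟨a, b, f⟩ y).1 hy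

/-! ### Limits of finite-dimensional discrete spaces -/

section DiscreteLimits

variable {k : Type u} [Field k] [TopologicalSpace k] [DiscreteTopology k]

section

variable {J : Type w} [Category.{w'} J] {F : J ⥤ TopModuleCat.{u} k} {c : Cone F}

/-- The morphism `k ⟶ X` sending `1` to `x`. -/
noncomputable def TopModuleCat.elementHom {X : TopModuleCat.{u} k} (x : X) :
    TopModuleCat.of k k ⟶ X :=
  ConcreteCategory.ofHom (C := TopModuleCat k)
    ⟨LinearMap.toSpanSingleton k X x, continuous_of_discreteTopology (α := k)⟩

theorem TopModuleCat.elementHom_apply_one {X : TopModuleCat.{u} k} (x : X) :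
    (elementHom x).hom (1 : k) = x := one_smul k x

theorem TopModuleCat.elementHom_comp {X Y : TopModuleCat.{u} k} (x : X) (f : X ⟶ Y) :
    elementHom x ≫ f = elementHom (f.hom x) := by
  exact ConcreteCategory.hom_ext _ _ fun t : k => f.hom.map_smul t x

/-- As `k` is discrete, the elements of a space are the morphisms from `k`, so the universal
property can be tested on elements. -/
theorem TopModuleCat.isLimit_ext (hc : IsLimit c) {x y : c.pt}
    (h : ∀ j, (c.π.app j).hom x = (c.π.app j).hom y) : x = y := by
  have : elementHom x = elementHom y := hc.hom_ext fun j => by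
    rw [elementHom_comp, elementHom_comp, h]
  rw [← elementHom_apply_one x, this, elementHom_apply_one]

theorem TopModuleCat.isLimit_exists (hc : IsLimit c) (e : ∀ j, F.obj j)
    (he : ∀ {a b : J} (f : a ⟶ b), (F.map f).hom (e a) = e b) :
    ∃ x : c.pt, ∀ j, (c.π.app j).hom x = e j := by
  let s : Cone F :=
    { pt := TopModuleCat.of k k
      π := { app := fun j => elementHom (e j)
             naturality := fun a b f => by
              rw [elementHom_comp, he]
              exact Category.id_comp _ } }
  refine ⟨(hc.lift s).hom (1 : k), fun j => ?_⟩
  have := hc.fac s j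
  rw [← elementHom_apply_one (e j)]
  exact congrArg (fun g : TopModuleCat.of k k ⟶ F.obj j => g.hom (1 : k)) this

theorem TopModuleCat.isLimit_topology (hc : IsLimit c) :
    c.pt.topologicalSpace = ⨅ j, (F.obj j).topologicalSpace.induced (c.π.app j).hom := by
  refine le_antisymm (le_iInf fun j => continuous_iff_le_induced.1 (c.π.app j).hom.continuous) ?_
  -- The same module with the initial topology is again a cone. Its lift is the identity on points,
  -- and continuity of this lift is the missing inequality of topologies.
  let s : Cone F := ofCone ((forget₂ _ (ModuleCat k)).mapCone c)
  let l : c.pt → c.pt := fun x => (hc.lift s).hom x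
  have h : l = id := funext fun x => isLimit_ext hc fun j =>
    congrArg (fun g : s.pt ⟶ F.obj j => g.hom x) (hc.fac s j)
  have h2 : s.pt.topologicalSpace ≤ c.pt.topologicalSpace.induced l :=
    continuous_iff_le_induced.1 (hc.lift s).hom.continuous
  rw [h, induced_id] at h2
  exact h2

end

/-- The linear map underlying a morphism to a discrete space. -/
def discreteFunctor.toLin {X : TopModuleCat.{u} k} {E : FGModuleCat.{u} k}
    (f : X ⟶ (discreteFunctor k).obj E) : X →ₗ[k] E := f.hom.toLinearMap

/-- The morphism to a discrete space given by a linear map with open kernel. -/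
def discreteFunctor.ofLin {X : TopModuleCat.{u} k} {E : FGModuleCat.{u} k} (f : X →ₗ[k] E)
    (hf : IsOpen (f.ker : Set X)) : X ⟶ (discreteFunctor k).obj E :=
  ConcreteCategory.ofHom (C := TopModuleCat k) (Y := (discreteFunctor k).obj E) ⟨f, by
    let _ : TopologicalSpace E := ⊥
    have : DiscreteTopology E := ⟨rfl⟩
    change Continuous f
    refine continuous_of_continuousAt_zero f ?_
    rw [ContinuousAt, map_zero, nhds_discrete E, Filter.tendsto_pure]
    exact hf.mem_nhds (zero_mem _)⟩

namespace discreteFunctor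

variable {X Y : TopModuleCat.{u} k} {E E' : FGModuleCat.{u} k}

theorem toLin_injective {f g : X ⟶ (discreteFunctor k).obj E} (h : toLin f = toLin g) : f = g := by
  ext x
  exact congrArg (fun a : X →ₗ[k] E => a x) h

theorem isOpen_ker_toLin (f : X ⟶ (discreteFunctor k).obj E) : IsOpen ((toLin f).ker : Set X) := by
  let _ : TopologicalSpace E := ⊥
  have : DiscreteTopology E := ⟨rfl⟩
  have : Continuous (toLin f) := f.hom.continuous
  exact (isOpen_discrete ({0} : Set E)).preimage this

end discreteFunctor

open discreteFunctor

section

variable {J : Type w} [Category.{w'} J] {G : J ⥤ FGModuleCat.{u} k}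
  {c : Cone (G ⋙ discreteFunctor k)}

/-- The linear projections of a cone of discrete spaces. -/
def discreteFunctor.coneProj (c : Cone (G ⋙ discreteFunctor k)) (j : J) : c.pt →ₗ[k] G.obj j :=
  toLin (X := c.pt) (E := G.obj j) (c.π.app j)

theorem discreteFunctor.isOpen_ker_coneProj (c : Cone (G ⋙ discreteFunctor k)) (j : J) :
    IsOpen ((coneProj c j).ker : Set c.pt) :=
  isOpen_ker_toLin (X := c.pt) (E := G.obj j) (c.π.app j)

theorem discreteFunctor.coneProj_map (c : Cone (G ⋙ discreteFunctor k)) {a b : J} (f : a ⟶ b)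
    (x : c.pt) : (G.map f).hom.hom (coneProj c a x) =
      coneProj c b x := by
  exact congrArg (fun g => toLin (X := c.pt) (E := G.obj b) g x) (c.w f)

theorem discreteFunctor.limit_ext (hc : IsLimit c) {x y : c.pt}
    (h : ∀ j, coneProj c j x = coneProj c j y) : x = y :=
  TopModuleCat.isLimit_ext hc h

theorem discreteFunctor.limit_exists (hc : IsLimit c) (e : ∀ j, G.obj j)
    (he : ∀ {a b : J} (f : a ⟶ b), (G.map f).hom.hom (e a) = e b) :
    ∃ x : c.pt, ∀ j, coneProj c j x = e j :=
  TopModuleCat.isLimit_exists hc e he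

theorem discreteFunctor.nhds_zero_eq_iInf (hc : IsLimit c) :
    𝓝 (0 : c.pt) = ⨅ j, Filter.principal ((coneProj c j).ker : Set c.pt) := by
  have h1 : 𝓝 (0 : c.pt) = @nhds c.pt (⨅ j, ((G ⋙ discreteFunctor k).obj j).topologicalSpace.induced
    (c.π.app j).hom) 0 := congrArg (fun t => @nhds c.pt t 0) (TopModuleCat.isLimit_topology hc)
  rw [h1, nhds_iInf]
  refine iInf_congr fun j => ?_
  let _ : TopologicalSpace (G.obj j) := ⊥
  have : DiscreteTopology (G.obj j) := ⟨rfl⟩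
  refine (nhds_induced (coneProj c j) 0).trans ?_
  rw [map_zero, nhds_discrete, ← Filter.principal_singleton, Filter.comap_principal]
  rfl

theorem discreteFunctor.limit_nhds (hc : IsLimit c) {U : Set c.pt} (hU : U ∈ 𝓝 (0 : c.pt)) :
    ∃ S : Finset J, ∀ y, (∀ j ∈ S, coneProj c j y = 0) → y ∈ U := by
  rw [nhds_zero_eq_iInf hc, Filter.mem_iInf_finite] at hU
  obtain ⟨S, hS⟩ := hU
  rw [Filter.iInf_principal_finset, Filter.mem_principal] at hS
  exact ⟨S, fun y hy => hS (Set.mem_iInter₂.2 hy)⟩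

theorem discreteFunctor.limit_isLinearlyCompact (hc : IsLimit c) : IsLinearlyCompact k c.pt := by
  classical
  refine IsLinearlyCompact.of_family (fun j => coneProj c j)
    (fun j => isOpen_ker_coneProj c j) (fun U hU => limit_nhds hc hU)
    (fun x hx => limit_ext hc fun j => by rw [hx, map_zero]) fun e he =>
      limit_exists hc e fun {a b} f => ?_
  obtain ⟨y, hy⟩ := he {a, b}
  rw [← hy a (by simp), ← hy b (by simp)]
  exact coneProj_map c f y

theorem discreteFunctor.limit_surjective [IsCofiltered J] (hc : IsLimit c)
    (hG : ∀ {a b : J} (f : a ⟶ b), Function.Surjective (G.map f).hom.hom) (j : J) :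
    Function.Surjective (coneProj c j) := fun e => by
  obtain ⟨x, hx, hxf⟩ := FGModuleCat.exists_section_of_surjective G hG j e
  obtain ⟨y, hy⟩ := limit_exists hc x hxf
  exact ⟨y, by rw [hy, hx]⟩

theorem discreteFunctor.limit_isCountablyGenerated [Countable J] (hc : IsLimit c) :
    (𝓝 (0 : c.pt)).IsCountablyGenerated := by
  rw [nhds_zero_eq_iInf hc]
  infer_instance

/-- In a cofiltered limit of discrete spaces the kernels of the projections form a neighbourhood
basis of zero. -/
theorem discreteFunctor.limit_nhds_of_isCofiltered [IsCofiltered J] (hc : IsLimit c) {U : Set c.pt}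
    (hU : U ∈ 𝓝 (0 : c.pt)) : ∃ j, ∀ y, coneProj c j y = 0 → y ∈ U := by
  obtain ⟨S, hS⟩ := limit_nhds hc hU
  obtain ⟨j, hj⟩ := IsCofiltered.inf_objs_exists S
  refine ⟨j, fun y hy => hS y fun a ha => ?_⟩
  obtain ⟨f⟩ := hj ha
  rw [← coneProj_map c f, hy, map_zero]

/-- A criterion for a cone of discrete spaces to be a limit cone. -/
theorem discreteFunctor.nonempty_isLimit (c : Cone (G ⋙ discreteFunctor k))
    (hinj : ∀ x, (∀ j, coneProj c j x = 0) → x = 0)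
    (hex : ∀ e : ∀ j, G.obj j, (∀ {a b : J} (f : a ⟶ b), (G.map f).hom.hom (e a) = e b) →
      ∃ x : c.pt, ∀ j, coneProj c j x = e j)
    (hnhds : ∀ U ∈ 𝓝 (0 : c.pt),
      ∃ S : Finset J, ∀ y, (∀ j ∈ S, coneProj c j y = 0) → y ∈ U) :
    Nonempty (IsLimit c) := by
  have hinj' : ∀ x y, (∀ j, coneProj c j x =
      coneProj c j y) → x = y := fun x y h =>
    sub_eq_zero.1 (hinj _ fun j => by rw [map_sub, h, sub_self])
  have hl : ∀ s : Cone (G ⋙ discreteFunctor k), ∃ l : s.pt →L[k] c.pt, ∀ j x,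
      coneProj c j (l x) = coneProj s j x := by
    intro s
    choose l hl using fun x : s.pt => hex (fun j => coneProj s j x)
      fun f => coneProj_map s f x
    let l' : s.pt →ₗ[k] c.pt :=
      { toFun := l
        map_add' := fun x y => hinj' _ _ fun j => by simp [hl]
        map_smul' := fun t x => hinj' _ _ fun j => by simp [hl] }
    refine ⟨⟨l', continuous_of_continuousAt_zero l' ?_⟩, fun j x => hl x j⟩
    rw [ContinuousAt, map_zero]
    intro U hU
    obtain ⟨S, hS⟩ := hnhds U hU
    have : IsOpen (⋂ j ∈ S, ((coneProj s j).ker : Set s.pt)) :=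
      isOpen_biInter_finset fun j _ => isOpen_ker_coneProj s j
    rw [Filter.mem_map]
    refine Filter.mem_of_superset (this.mem_nhds (x := 0) (by simp)) fun x hx => hS _ fun j hj => ?_
    rw [show l' x = l x from rfl, hl]
    exact Set.mem_iInter₂.1 hx j hj
  choose l hl using hl
  exact ⟨
    { lift := fun s => ConcreteCategory.ofHom (C := TopModuleCat k) (l s)
      fac := fun s j => toLin_injective (X := s.pt) (E := G.obj j) (LinearMap.ext fun x => hl s j x)
      uniq := fun s m hm => by
        ext x
        refine hinj' _ _ fun j => ?_
        exact (congrArg (fun g => toLin (X := s.pt) (E := G.obj j) g x) (hm j)).trans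
          (hl s j x).symm }⟩

end

end DiscreteLimits

/-! ### Admissible functors and their realizations by filtered spaces -/

section Realizations

variable {k : Type u} [Field k]

section Admissible

theorem FGModuleCat.shortExact_iff {S : ShortComplex (FGModuleCat.{v} k)} :
    S.ShortExact ↔ Function.Injective S.f.hom.hom ∧ Function.Surjective S.g.hom.hom ∧
      ∀ y, S.g.hom.hom y = 0 → ∃ x, S.f.hom.hom x = y := by
  let Φ := forget₂ (FGModuleCat.{v} k) (ModuleCat.{v} k)
  have h1 : S.Exact ↔ ∀ y, S.g.hom.hom y = 0 → ∃ x, S.f.hom.hom x = y := by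
    rw [← ShortComplex.exact_map_iff_of_faithful S Φ, ShortComplex.moduleCat_exact_iff]
    rfl
  have h2 : Mono S.f ↔ Function.Injective S.f.hom.hom := by
    rw [← Functor.mono_map_iff_mono Φ, ModuleCat.mono_iff_injective]
    rfl
  have h3 : Epi S.g ↔ Function.Surjective S.g.hom.hom := by
    rw [← Functor.epi_map_iff_epi Φ, ModuleCat.epi_iff_surjective]
    rfl
  rw [← h1, ← h2, ← h3]
  exact ⟨fun h => ⟨h.mono_f, h.epi_g, h.exact⟩, fun h =>
    { exact := h.2.2, mono_f := h.1, epi_g := h.2.1 }⟩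

theorem FGModuleCat.surjective_of_epi {E E' : FGModuleCat.{v} k} (f : E ⟶ E') [Epi f] :
    Function.Surjective f.hom.hom := by
  have : Epi ((forget₂ (FGModuleCat.{v} k) (ModuleCat.{v} k)).map f) := inferInstance
  exact (ModuleCat.epi_iff_surjective _).1 this

theorem FGModuleCat.epi_of_surjective {E E' : FGModuleCat.{v} k} (f : E ⟶ E')
    (hf : Function.Surjective f.hom.hom) : Epi f :=
  (forget₂ (FGModuleCat.{v} k) (ModuleCat.{v} k)).epi_of_epi_map
    ((ModuleCat.epi_iff_surjective _).2 hf)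

variable {X : TateIdx ⥤ FGModuleCat.{v} k}

theorem IsAdmissibleBiFun.map_injective (hX : IsAdmissibleBiFun _ X) {i j l : ℤ} (hij : i ≤ j)
    (hjl : j ≤ l) :
    Function.Injective (X.map (TateIdx.hom hij (hij.trans hjl) le_rfl hjl)).hom.hom := by
  obtain ⟨w, h⟩ := hX i j l hij hjl
  exact (FGModuleCat.shortExact_iff.1 h).1

theorem IsAdmissibleBiFun.map_surjective (hX : IsAdmissibleBiFun _ X) {i j l : ℤ} (hij : i ≤ j)
    (hjl : j ≤ l) :
    Function.Surjective (X.map (TateIdx.hom (hij.trans hjl) hjl hij le_rfl)).hom.hom := by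
  obtain ⟨w, h⟩ := hX i j l hij hjl
  exact (FGModuleCat.shortExact_iff.1 h).2.1

theorem IsAdmissibleBiFun.map_eq_zero_iff (hX : IsAdmissibleBiFun _ X) {i j l : ℤ} (hij : i ≤ j)
    (hjl : j ≤ l) (y : X.obj (TateIdx.mk i l (hij.trans hjl))) :
    (X.map (TateIdx.hom (hij.trans hjl) hjl hij le_rfl)).hom.hom y = 0 ↔
      ∃ x, (X.map (TateIdx.hom hij (hij.trans hjl) le_rfl hjl)).hom.hom x = y := by
  obtain ⟨w, h⟩ := hX i j l hij hjl
  refine ⟨(FGModuleCat.shortExact_iff.1 h).2.2 y, ?_⟩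
  rintro ⟨x, rfl⟩
  exact congrArg (fun f => f.hom.hom x) w

/-- For three equal indices both maps of the exact sequence are identities. -/
theorem IsAdmissibleBiFun.eq_zero (hX : IsAdmissibleBiFun _ X) {j : ℤ}
    (x : X.obj (TateIdx.mk j j le_rfl)) : x = 0 := by
  have h : TateIdx.hom le_rfl le_rfl le_rfl le_rfl = 𝟙 (TateIdx.mk j j le_rfl) := rfl
  have := (hX.map_eq_zero_iff (le_refl j) (le_refl j) x).2 ⟨x, by rw [h, X.map_id]; rfl⟩
  rw [h, X.map_id] at this
  exact this

end Admissible

variable [TopologicalSpace k]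

/-- A realization of a functor `X` on `Π` by a topological vector space `V`: a complete, separated
and exhaustive filtration of `V` by open subspaces with subquotients `L j / L i ≃ X i j`. -/
structure TateRealization (X : TateIdx ⥤ FGModuleCat.{u} k) (V : TopModuleCat.{u} k) where
  /-- The filtration. -/
  L : ℤ → Submodule k V
  mono : Monotone L
  isOpen : ∀ j, IsOpen (L j : Set V)
  exists_le : ∀ U ∈ 𝓝 (0 : V), ∃ j, (L j : Set V) ⊆ U
  exists_mem : ∀ x, ∃ j, x ∈ L j
  separated : ∀ x, (∀ j, x ∈ L j) → x = 0
  complete : ∀ v : ℤ → V, (∀ i i', i ≤ i' → v i - v i' ∈ L i') → ∃ x, ∀ i, x - v i ∈ L i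
  /-- The projections to the subquotients. -/
  proj : ∀ q : TateIdx, L q.1.2 →ₗ[k] X.obj q
  proj_surjective : ∀ q, Function.Surjective (proj q)
  proj_eq_zero_iff : ∀ q x, proj q x = 0 ↔ (x : V) ∈ L q.1.1
  map_proj : ∀ {q q' : TateIdx} (f : q ⟶ q') (x : L q.1.2),
    (X.map f).hom.hom (proj q x) = proj q' ⟨x, mono (leOfHom f).2 x.2⟩

namespace TateRealization

variable {X Y Z : TateIdx ⥤ FGModuleCat.{u} k} {V W U : TopModuleCat.{u} k}
  (R : TateRealization X V) (S : TateRealization Y W) (Q : TateRealization Z U)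

theorem proj_eq_iff (q : TateIdx) (x y : R.L q.1.2) :
    R.proj q x = R.proj q y ↔ (x : V) - y ∈ R.L q.1.1 := by
  rw [← sub_eq_zero, ← map_sub, R.proj_eq_zero_iff]
  rfl

/-- A morphism `T` of topological vector spaces respects the filtrations and induces `f` on the
subquotients. -/
def Compat (f : X ⟶ Y) (T : V ⟶ W) : Prop :=
  ∀ (q : TateIdx) (x : R.L q.1.2), ∃ h : T.hom x ∈ S.L q.1.2,
    S.proj q ⟨T.hom x, h⟩ = (f.app q).hom.hom (R.proj q x)

variable {R S Q}

/-- Compatibility determines `T x` modulo every step of the filtration, and the filtration is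
separated. -/
theorem Compat.unique {f : X ⟶ Y} {T T' : V ⟶ W} (h : R.Compat S f T) (h' : R.Compat S f T') :
    T = T' := by
  refine ConcreteCategory.hom_ext _ _ fun x => sub_eq_zero.1 (S.separated _ fun i => ?_)
  obtain ⟨j, hj⟩ := R.exists_mem x
  obtain hij | hij := le_total i j
  · obtain ⟨h1, h2⟩ := h (TateIdx.mk i j hij) ⟨x, hj⟩
    obtain ⟨h1', h2'⟩ := h' (TateIdx.mk i j hij) ⟨x, hj⟩
    exact (S.proj_eq_iff (TateIdx.mk i j hij) ⟨_, h1⟩ ⟨_, h1'⟩).1 (h2.trans h2'.symm)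
  · exact S.mono hij (sub_mem (h (TateIdx.mk j j le_rfl) ⟨x, hj⟩).1
      (h' (TateIdx.mk j j le_rfl) ⟨x, hj⟩).1)

theorem Compat.comp {f : X ⟶ Y} {g : Y ⟶ Z} {T : V ⟶ W} {T' : W ⟶ U} (h : R.Compat S f T)
    (h' : S.Compat Q g T') : R.Compat Q (f ≫ g) (T ≫ T') := by
  intro q x
  obtain ⟨h1, h2⟩ := h q x
  obtain ⟨h3, h4⟩ := h' q ⟨_, h1⟩
  exact ⟨h3, h4.trans (by rw [h2]; rfl)⟩

/-- The components of `f` are determined because the projections of `R` are surjective. -/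
theorem Compat.injective {f f' : X ⟶ Y} {T : V ⟶ W} (h : R.Compat S f T) (h' : R.Compat S f' T) :
    f = f' := by
  ext q : 2
  refine FGModuleCat.hom_ext (LinearMap.ext fun y => ?_)
  obtain ⟨x, rfl⟩ := R.proj_surjective q y
  exact (h q x).2.symm.trans (h' q x).2

variable (R S)

theorem compat_id : R.Compat R (𝟙 X) (𝟙 V) := fun _ x => ⟨x.2, rfl⟩

/-- A morphism respecting the filtrations induces a natural transformation. -/
theorem exists_hom_compat (T : V ⟶ W) (hT : ∀ j, ∀ x ∈ R.L j, T.hom x ∈ S.L j) :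
    ∃ f : X ⟶ Y, R.Compat S f T := by
  have h : ∀ q : TateIdx, ∃ g : X.obj q →ₗ[k] Y.obj q, ∀ x : R.L q.1.2,
      g (R.proj q x) = S.proj q ⟨T.hom x, hT _ _ x.2⟩ := by
    intro q
    let T' : R.L q.1.2 →ₗ[k] S.L q.1.2 := T.hom.toLinearMap.restrict (hT q.1.2)
    have hker : (R.proj q).ker ≤ (S.proj q ∘ₗ T').ker := fun x hx => by
      rw [LinearMap.mem_ker, R.proj_eq_zero_iff] at hx
      rw [LinearMap.mem_ker, LinearMap.comp_apply, S.proj_eq_zero_iff]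
      exact hT _ _ hx
    let e := (R.proj q).quotKerEquivOfSurjective (R.proj_surjective q)
    refine ⟨(R.proj q).ker.liftQ (S.proj q ∘ₗ T') hker ∘ₗ e.symm.toLinearMap, fun x => ?_⟩
    have : e.symm (R.proj q x) = (R.proj q).ker.mkQ x := by
      rw [LinearEquiv.symm_apply_eq]
      rfl
    rw [LinearMap.comp_apply, LinearEquiv.coe_coe, this, Submodule.mkQ_apply,
      Submodule.liftQ_apply]
    rfl
  choose g hg using h
  refine ⟨{ app := fun q => FGModuleCat.ofHom (g q), naturality := fun q q' a => ?_ }, fun q x =>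
    ⟨hT _ _ x.2, (hg q x).symm⟩⟩
  refine FGModuleCat.hom_ext (LinearMap.ext fun y => ?_)
  obtain ⟨x, rfl⟩ := R.proj_surjective q y
  change g q' ((X.map a).hom.hom (R.proj q x)) = (Y.map a).hom.hom (g q (R.proj q x))
  rw [R.map_proj, hg, hg, S.map_proj]

variable {R S} in
theorem app_proj (f : X ⟶ Y) {q q' : TateIdx} (a : q ⟶ q') (x : R.L q.1.2) (w : S.L q.1.2)
    (h : S.proj q w = (f.app q).hom.hom (R.proj q x)) :
    S.proj q' ⟨w, S.mono (leOfHom a).2 w.2⟩ =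
      (f.app q').hom.hom (R.proj q' ⟨x, R.mono (leOfHom a).2 x.2⟩) := by
  rw [← S.map_proj a, ← R.map_proj a, h]
  exact (congrArg (fun g => g.hom.hom (R.proj q x)) (f.naturality a)).symm

/-- A natural transformation induces a morphism of realizations. -/
theorem exists_compat (f : X ⟶ Y) : ∃ T : V ⟶ W, R.Compat S f T := by
  let P : V → W → Prop := fun x y => ∀ (q : TateIdx) (hx : x ∈ R.L q.1.2),
    ∃ hy : y ∈ S.L q.1.2, S.proj q ⟨y, hy⟩ = (f.app q).hom.hom (R.proj q ⟨x, hx⟩)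
  have hP : ∀ x, ∃ y, P x y := by
    intro x
    obtain ⟨j, hj⟩ := R.exists_mem x
    -- The vector `v i` approximates the image of `x` modulo `L (min i j)`; by naturality the
    -- approximations are coherent, and completeness gives their limit `y`.
    choose v hv using fun i => S.proj_surjective (TateIdx.mk (min i j) j (min_le_right i j))
      ((f.app _).hom.hom (R.proj (TateIdx.mk (min i j) j (min_le_right i j)) ⟨x, hj⟩))
    obtain ⟨y, hy⟩ := S.complete (fun i => v i) fun i i' h => S.mono (min_le_left i' j) <| by
      refine (S.proj_eq_iff (TateIdx.mk (min i' j) j (min_le_right i' j)) (v i) (v i')).1 ?_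
      exact (app_proj f (TateIdx.hom (min_le_right i j) (min_le_right i' j)
        (min_le_min_right j h) le_rfl) ⟨x, hj⟩ (v i) (hv i)).trans (hv i').symm
    refine ⟨y, fun q hx => ?_⟩
    -- The stage `j` was arbitrary. To reach a given `q`, both descriptions are compared in the
    -- common stage `(q.1.1, max q.1.2 j)`.
    obtain ⟨w, hw⟩ := S.proj_surjective q ((f.app q).hom.hom (R.proj q ⟨x, hx⟩))
    have hqm : q.1.1 ≤ max q.1.2 j := q.2.trans (le_max_left _ _)
    have h1 := app_proj f (TateIdx.hom q.2 hqm le_rfl (le_max_left _ _)) ⟨x, hx⟩ w hw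
    have h2 := app_proj f (TateIdx.hom (min_le_right q.1.1 j) hqm (min_le_left _ _)
      (le_max_right _ _)) ⟨x, hj⟩ (v q.1.1) (hv q.1.1)
    have h3 := (S.proj_eq_iff (TateIdx.mk _ _ hqm) _ _).1 (h2.trans h1.symm)
    have h4 : y - w ∈ S.L q.1.1 := by simpa using add_mem (hy q.1.1) h3
    have h5 : y ∈ S.L q.1.2 := by simpa using add_mem (S.mono q.2 h4) w.2
    exact ⟨h5, ((S.proj_eq_iff q ⟨y, h5⟩ w).2 h4).trans hw⟩
  have hmem : ∀ (x y : V), ∃ j, x ∈ R.L j ∧ y ∈ R.L j := fun x y => by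
    obtain ⟨i, hi⟩ := R.exists_mem x
    obtain ⟨j, hj⟩ := R.exists_mem y
    exact ⟨max i j, R.mono (le_max_left _ _) hi, R.mono (le_max_right _ _) hj⟩
  -- it suffices to know the values on a single step of the filtration
  have hP' : ∀ x y j, x ∈ R.L j → (∀ (i : ℤ) (hij : i ≤ j) (hx : x ∈ R.L j), ∃ hy : y ∈ S.L j,
      S.proj (TateIdx.mk i j hij) ⟨y, hy⟩ =
        (f.app _).hom.hom (R.proj (TateIdx.mk i j hij) ⟨x, hx⟩)) → ∀ z, P x z → z = y := by
    intro x y j hj h z hz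
    refine sub_eq_zero.1 (S.separated _ fun i => ?_)
    obtain hij | hij := le_total i j
    · obtain ⟨h1, h2⟩ := hz (TateIdx.mk i j hij) hj
      obtain ⟨h1', h2'⟩ := h i hij hj
      exact (S.proj_eq_iff (TateIdx.mk i j hij) ⟨_, h1⟩ ⟨_, h1'⟩).1 (h2.trans h2'.symm)
    · exact S.mono hij (sub_mem (hz (TateIdx.mk j j le_rfl) hj).1 (h j le_rfl hj).1)
  choose T hT using hP
  let T' : V →ₗ[k] W :=
    { toFun := T
      map_add' := fun x y => by
        obtain ⟨j, hx, hy⟩ := hmem x y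
        refine hP' (x + y) _ j (add_mem hx hy) (fun i hij h => ?_) _ (hT _)
        obtain ⟨h1, h2⟩ := hT x (TateIdx.mk i j hij) hx
        obtain ⟨h1', h2'⟩ := hT y (TateIdx.mk i j hij) hy
        refine ⟨add_mem h1 h1', ?_⟩
        refine ((S.proj (TateIdx.mk i j hij)).map_add ⟨_, h1⟩ ⟨_, h1'⟩).trans ?_
        rw [h2, h2', ← map_add, ← map_add]
        rfl
      map_smul' := fun t x => by
        obtain ⟨j, hx⟩ := R.exists_mem x
        refine hP' (t • x) _ j ((R.L j).smul_mem t hx) (fun i hij h => ?_) _ (hT _)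
        obtain ⟨h1, h2⟩ := hT x (TateIdx.mk i j hij) hx
        refine ⟨(S.L j).smul_mem t h1, ?_⟩
        refine ((S.proj (TateIdx.mk i j hij)).map_smul t ⟨_, h1⟩).trans ?_
        rw [h2, ← map_smul, ← map_smul]
        rfl }
  refine ⟨ConcreteCategory.ofHom (C := TopModuleCat k) ⟨T', continuous_of_continuousAt_zero T' ?_⟩,
    fun q x => hT x q x.2⟩
  rw [ContinuousAt, map_zero]
  intro U hU
  obtain ⟨j, hj⟩ := S.exists_le U hU
  rw [Filter.mem_map]
  exact Filter.mem_of_superset ((R.isOpen j).mem_nhds (zero_mem _)) fun x hx =>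
    hj (hT x (TateIdx.mk j j le_rfl) hx).1

/-- Two realizations of a functor are canonically isomorphic. -/
theorem exists_iso (S : TateRealization X W) :
    ∃ e : V ≅ W, R.Compat S (𝟙 X) e.hom ∧ S.Compat R (𝟙 X) e.inv := by
  obtain ⟨T, hT⟩ := R.exists_compat S (𝟙 X)
  obtain ⟨T', hT'⟩ := S.exists_compat R (𝟙 X)
  have h1 := hT.comp hT'
  have h2 := hT'.comp hT
  rw [Category.comp_id] at h1 h2
  exact ⟨⟨T, T', h1.unique R.compat_id, h2.unique S.compat_id⟩, hT, hT'⟩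

theorem Compat.congr {R : TateRealization X V} {S : TateRealization Y W} {f f' : X ⟶ Y} {T : V ⟶ W}
    (h : R.Compat S f T) (e : f = f') : R.Compat S f' T := e ▸ h

theorem _root_.Bicofinal.exists_apply_le (φ : Bicofinal) (n : ℤ) : ∃ m, φ.toFun m ≤ n :=
  (φ.tendsto_atBot.eventually (Filter.eventually_le_atBot n)).exists

theorem _root_.Bicofinal.exists_le_apply (φ : Bicofinal) (n : ℤ) : ∃ m, n ≤ φ.toFun m :=
  (φ.tendsto_atTop.eventually (Filter.eventually_ge_atTop n)).exists

/-- The realization of `X ∘ φ̃` induced by a realization of `X`. -/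
noncomputable def reindex (φ : Bicofinal) : TateRealization (φ.tilde ⋙ X) V where
  L n := R.L (φ.toFun n)
  mono _ _ h := R.mono (φ.monotone' h)
  isOpen _ := R.isOpen _
  exists_le U hU := by
    obtain ⟨j, hj⟩ := R.exists_le U hU
    obtain ⟨m, hm⟩ := φ.exists_apply_le j
    exact ⟨m, fun x hx => hj (R.mono hm hx)⟩
  exists_mem x := by
    obtain ⟨j, hj⟩ := R.exists_mem x
    obtain ⟨m, hm⟩ := φ.exists_le_apply j
    exact ⟨m, R.mono hm hj⟩
  separated x hx := R.separated x fun j => by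
    obtain ⟨m, hm⟩ := φ.exists_apply_le j
    exact R.mono hm (hx m)
  complete v hv := by
    -- A family coherent along `φ` is turned into one indexed by all integers through `s n` with `φ
    -- (s n) ≤ n`; two indices are compared through their minimum.
    choose s hs using φ.exists_apply_le
    have key : ∀ i n l, φ.toFun i ≤ l → φ.toFun n ≤ l → v i - v n ∈ R.L l := fun i n l hi hn => by
      have h1 := R.mono hi (hv (min i n) i (min_le_left _ _))
      have h2 := R.mono hn (hv (min i n) n (min_le_right _ _))
      simpa using sub_mem h2 h1
    obtain ⟨x, hx⟩ := R.complete (fun n => v (s n)) fun i i' h =>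
      key _ _ _ ((hs i).trans h) (hs i')
    exact ⟨x, fun i => by
      simpa using add_mem (hx (φ.toFun i)) (key (s (φ.toFun i)) i _ (hs _) le_rfl)⟩
  proj q := R.proj (φ.tilde.obj q)
  proj_surjective q := R.proj_surjective _
  proj_eq_zero_iff q x := R.proj_eq_zero_iff (φ.tilde.obj q) x
  map_proj f x := R.map_proj (φ.tilde.map f) x

/-- Each `L j` is the limit of the finite-dimensional `X_{ij}` for `i ≤ j`: separatedness gives
injectivity, and completeness lifts consistent families. -/
theorem isLinearlyCompact (j : ℤ) : IsLinearlyCompact k (R.L j) := by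
  classical
  let P : ∀ i : Set.Iic j, R.L j →ₗ[k] X.obj (TateIdx.mk i j i.2) := fun i =>
    R.proj (TateIdx.mk i j i.2)
  have hP : ∀ i x, P i x = 0 ↔ (x : V) ∈ R.L i := fun i x =>
    R.proj_eq_zero_iff (TateIdx.mk i j i.2) x
  have hP' : ∀ i x y, P i x = P i y ↔ (x : V) - y ∈ R.L i := fun i x y =>
    R.proj_eq_iff (TateIdx.mk i j i.2) x y
  refine IsLinearlyCompact.of_family P (fun i => ?_) (fun U hU => ?_) (fun x hx => ?_)
    fun e he => ?_
  · have : ((P i).ker : Set (R.L j)) = Subtype.val ⁻¹' (R.L i : Set V) := by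
      ext x
      exact hP i x
    rw [this]
    exact (R.isOpen i).preimage continuous_subtype_val
  · rw [mem_nhds_subtype] at hU
    obtain ⟨U', hU', h⟩ := hU
    obtain ⟨m, hm⟩ := R.exists_le U' hU'
    refine ⟨{⟨min m j, Set.mem_Iic.2 (min_le_right _ _)⟩}, fun y hy => h (hm ?_)⟩
    exact R.mono (min_le_left _ _) ((hP _ _).1 (hy _ (Finset.mem_singleton_self _)))
  · refine Subtype.ext (R.separated _ fun i => ?_)
    obtain hij | hij := le_total i j
    · exact (hP ⟨i, hij⟩ x).1 (hx _)
    · exact R.mono hij x.2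
  · choose v hv using fun i : Set.Iic j => R.proj_surjective (TateIdx.mk i j i.2) (e i)
    -- Above `j` the values may be anything in `L j`, since coherence modulo larger steps is then
    -- automatic.
    let v' : ℤ → R.L j := fun i => if h : i ≤ j then v ⟨i, h⟩ else v ⟨j, Set.mem_Iic.2 le_rfl⟩
    have hv' : ∀ i (h : i ≤ j), v' i = v ⟨i, h⟩ := fun i h => dif_pos h
    obtain ⟨x, hx⟩ := R.complete (fun i => v' i) fun i i' h => by
      by_cases hi' : i' ≤ j
      · rw [hv' i (h.trans hi'), hv' i' hi']
        obtain ⟨y, hy⟩ := he {⟨i, h.trans hi'⟩, ⟨i', hi'⟩}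
        have h1 := (hP' _ _ _).1 ((hy ⟨i, h.trans hi'⟩ (by simp)).trans (hv _).symm)
        have h2 := (hP' _ _ _).1 ((hy ⟨i', hi'⟩ (by simp)).trans (hv _).symm)
        simpa using sub_mem h2 (R.mono h h1)
      · exact R.mono (le_of_not_ge hi') (sub_mem (v' i).2 (v' i').2)
    have hxj : x ∈ R.L j := by simpa using add_mem (hx j) (v' j).2
    refine ⟨⟨x, hxj⟩, fun i => ?_⟩
    rw [← hv i]
    refine (hP' i ⟨x, hxj⟩ (v i)).2 ?_
    have := hx i
    rwa [hv' i i.2] at this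

theorem countableLLC (R : TateRealization X V) : countableLLCProp k V := by
  have hb : (𝓝 (0 : V)).HasBasis (fun _ : ℤ => True) fun j => (R.L j : Set V) :=
    ⟨fun U => ⟨fun hU => by simpa using R.exists_le U hU, fun ⟨j, _, h⟩ =>
      Filter.mem_of_superset ((R.isOpen j).mem_nhds (zero_mem _)) h⟩⟩
  refine ⟨⟨?_, IsLinearTopology.mk_of_hasBasis k hb, R.L 0, R.isOpen 0, R.isLinearlyCompact 0⟩,
    hb.isCountablyGenerated, ?_⟩
  · rw [IsTopologicalAddGroup.t2Space_iff_zero_closed, ← isOpen_compl_iff, isOpen_iff_mem_nhds]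
    intro x hx
    obtain ⟨j, hj⟩ : ∃ j, x ∉ R.L j := by
      by_contra! h
      exact hx (R.separated x h)
    have : (fun y => x - y) ⁻¹' (R.L j : Set V) ∈ 𝓝 x :=
      ((R.isOpen j).preimage (continuous_const.sub continuous_id)).mem_nhds (by simp)
    filter_upwards [this] with y hy hy0
    rw [Set.mem_singleton_iff] at hy0
    subst hy0
    exact hj (by simpa using hy)
  · refine ⟨fun n => R.L n, fun n => ⟨R.isOpen n, R.isLinearlyCompact n⟩, fun x => ?_⟩
    obtain ⟨j, hj⟩ := R.exists_mem x
    exact ⟨j.toNat, R.mono (Int.self_le_toNat j) hj⟩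

end TateRealization
end Realizations

/-! ### The canonical realization on `colim lim` -/

section ProLim

variable {k : Type u} [Field k]

section TateFunctor

variable {X : TateIdx ⥤ FGModuleCat.{u} k}

variable (X) in
theorem TateIdx.map_map {p q r : TateIdx} (f : p ⟶ q) (g : q ⟶ r) (h : p ⟶ r) (x : X.obj p) :
    (X.map g).hom.hom ((X.map f).hom.hom x) = (X.map h).hom.hom x := by
  rw [Subsingleton.elim h (f ≫ g), X.map_comp]
  rfl

/-- Index equalities are hypotheses so that exactness applies to indices such as `min i j`, which
agree only propositionally. -/
theorem IsAdmissibleBiFun.injective_of_eq (hX : IsAdmissibleBiFun _ X) {p q : TateIdx} (f : p ⟶ q)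
    (h : p.1.1 = q.1.1) : Function.Injective (X.map f).hom.hom := by
  obtain ⟨⟨a, b⟩, hp⟩ := p
  obtain ⟨⟨c, d⟩, hq⟩ := q
  obtain rfl : a = c := h
  exact hX.map_injective hp (leOfHom f).2

theorem IsAdmissibleBiFun.surjective_of_eq (hX : IsAdmissibleBiFun _ X) {p q : TateIdx} (f : p ⟶ q)
    (h : p.1.2 = q.1.2) : Function.Surjective (X.map f).hom.hom := by
  obtain ⟨⟨a, b⟩, hp⟩ := p
  obtain ⟨⟨c, d⟩, hq⟩ := q
  obtain rfl : b = d := h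
  exact hX.map_surjective (leOfHom f).1 hq

theorem IsAdmissibleBiFun.exists_of_map_eq_zero (hX : IsAdmissibleBiFun _ X) {p q r : TateIdx}
    (f : p ⟶ q) (g : q ⟶ r) (h₁ : p.1.1 = q.1.1) (h₂ : p.1.2 = r.1.1) (h₃ : q.1.2 = r.1.2)
    (y : X.obj q) (hy : (X.map g).hom.hom y = 0) : ∃ x, (X.map f).hom.hom x = y := by
  obtain ⟨⟨a, b⟩, hp⟩ := p
  obtain ⟨⟨c, d⟩, hq⟩ := q
  obtain ⟨⟨c', d'⟩, hr⟩ := r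
  obtain rfl : a = c := h₁
  obtain rfl : b = c' := h₂
  obtain rfl : d = d' := h₃
  exact (hX.map_eq_zero_iff hp hr y).1 hy

theorem IsAdmissibleBiFun.eq_zero_of_eq (hX : IsAdmissibleBiFun _ X) {p : TateIdx}
    (h : p.1.1 = p.1.2) (x : X.obj p) : x = 0 := by
  obtain ⟨⟨a, b⟩, hp⟩ := p
  obtain rfl : a = b := h
  exact hX.eq_zero x

end TateFunctor

variable [TopologicalSpace k]

/-- Forgetting the topology preserves the colimit, and filtered colimits of modules are computed on
sets. -/
theorem TopModuleCat.isColimit_exists_rep {F : ℤ ⥤ TopModuleCat.{u} k} {c : Cocone F}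
    (hc : IsColimit c) (x : c.pt) : ∃ j y, (c.ι.app j).hom y = x := by
  have : PreservesFilteredColimitsOfSize.{0, 0} (forget (ModuleCat.{u} k)) :=
    preservesFilteredColimitsOfSize_shrink.{0, u, 0, u} _
  have h := isColimitOfPreserves (forget₂ (TopModuleCat.{u} k) (ModuleCat.{u} k)) hc
  exact Concrete.isColimit_exists_rep _ h x

theorem TopModuleCat.isColimit_injective {F : ℤ ⥤ TopModuleCat.{u} k} {c : Cocone F}
    (hc : IsColimit c) (hF : ∀ {i j : ℤ} (f : i ⟶ j), Function.Injective (F.map f).hom) (j : ℤ) :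
    Function.Injective (c.ι.app j).hom := by
  have : PreservesFilteredColimitsOfSize.{0, 0} (forget (ModuleCat.{u} k)) :=
    preservesFilteredColimitsOfSize_shrink.{0, u, 0, u} _
  have h := isColimitOfPreserves (forget₂ (TopModuleCat.{u} k) (ModuleCat.{u} k)) hc
  intro x y hxy
  obtain ⟨l, f, g, hfg⟩ := Concrete.isColimit_exists_of_rep_eq _ h x y hxy
  obtain rfl : f = g := Subsingleton.elim _ _
  exact hF f hfg

variable [DiscreteTopology k]

variable (k) in
/-- The functor sending `X` to the projective limits `lim_i X_{ij}`, for `j : ℤ`. -/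
noncomputable def proLim : (TateIdx ⥤ FGModuleCat.{u} k) ⥤ ℤ ⥤ TopModuleCat.{u} k :=
  (Functor.whiskeringRight _ _ _).obj (discreteFunctor k) ⋙
    Functor.whiskeringRight ℤ TateIdx (TopModuleCat.{u} k) ⋙
    (Functor.whiskeringLeft ℤ (ℤ ⥤ TateIdx) (ℤ ⥤ TopModuleCat.{u} k)).obj extendIdx ⋙
    (Functor.whiskeringRight ℤ (ℤ ⥤ TopModuleCat.{u} k) (TopModuleCat.{u} k)).obj lim

namespace proLim
open discreteFunctor

variable (X : TateIdx ⥤ FGModuleCat.{u} k)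

/-- The limit cone of `lim_i X_{ij}`. -/
noncomputable def cone (j : ℤ) : Cone ((extendIdx.obj j ⋙ X) ⋙ discreteFunctor k) :=
  limit.cone _

/-- The projection from `lim_i X_{ij}` to `X_{ij}`. -/
noncomputable def π (j i : ℤ) :
    ((proLim k).obj X).obj j →ₗ[k] X.obj (TateIdx.mk (min i j) j (min_le_right i j)) :=
  coneProj (cone X j) i

theorem π_map {j j' : ℤ} (h : j ⟶ j') (i : ℤ) (y : ((proLim k).obj X).obj j) :
    π X j' i ((((proLim k).obj X).map h).hom y) =
      (X.map (TateIdx.hom (min_le_right i j) (min_le_right i j')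
        (min_le_min_left i (leOfHom h)) (leOfHom h))).hom.hom (π X j i y) := by
  have := limMap_π ((((Functor.whiskeringRight _ _ _).obj (discreteFunctor k) ⋙
    Functor.whiskeringRight ℤ TateIdx (TopModuleCat.{u} k) ⋙
    (Functor.whiskeringLeft ℤ (ℤ ⥤ TateIdx) (ℤ ⥤ TopModuleCat.{u} k)).obj extendIdx).obj X).map h) i
  exact congrArg (fun g => g.hom y) this

theorem π_app {X Y} (f : X ⟶ Y) (j i : ℤ) (y : ((proLim k).obj X).obj j) :
    π Y j i ((((proLim k).map f).app j).hom y) = (f.app _).hom.hom (π X j i y) := by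
  have := limMap_π (((((Functor.whiskeringRight _ _ _).obj (discreteFunctor k) ⋙
    Functor.whiskeringRight ℤ TateIdx (TopModuleCat.{u} k) ⋙
    (Functor.whiskeringLeft ℤ (ℤ ⥤ TateIdx) (ℤ ⥤ TopModuleCat.{u} k)).obj extendIdx).map f).app j)) i
  exact congrArg (fun g => g.hom y) this

/-- The morphism of `Π` from `(min i j, j)` to `(i, j)`. -/
noncomputable abbrev toIdx (q : TateIdx) :
    TateIdx.mk (min q.1.1 q.1.2) q.1.2 (min_le_right _ _) ⟶ q :=
  TateIdx.hom (min_le_right q.1.1 q.1.2) q.2 (min_le_left _ _) le_rfl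

variable {X}

theorem map_π {j i i' : ℤ} (h : i ≤ i') (y : ((proLim k).obj X).obj j) :
    (X.map (TateIdx.hom (min_le_right i j) (min_le_right i' j) (min_le_min_right j h)
      le_rfl)).hom.hom (π X j i y) = π X j i' y :=
  coneProj_map (cone X j) (homOfLE h) y

/-- Every component is the image of one with index at most `n`. -/
theorem ext_of_le {j : ℤ} (n : ℤ) {y : ((proLim k).obj X).obj j} (h : ∀ i ≤ n, π X j i y = 0) :
    y = 0 := by
  refine limit_ext (c := cone X j) (limit.isLimit _) fun i => ?_
  have h1 := map_π (X := X) (j := j) (min_le_left i n) y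
  rw [h _ (min_le_right i n), map_zero] at h1
  exact h1.symm.trans (map_zero (coneProj (cone X j) i)).symm

theorem exists_π_eq {j : ℤ}
    (e : ∀ i, X.obj (TateIdx.mk (min i j) j (min_le_right i j)))
    (he : ∀ i i' (h : i ≤ i'), (X.map (TateIdx.hom (min_le_right i j) (min_le_right i' j)
      (min_le_min_right j h) le_rfl)).hom.hom (e i) = e i') :
    ∃ y : ((proLim k).obj X).obj j, ∀ i, π X j i y = e i :=
  limit_exists (c := cone X j) (limit.isLimit _) e fun f => he _ _ (leOfHom f)

theorem exists_forall_mem_of_nhds {j : ℤ} {U : Set (((proLim k).obj X).obj j)} (hU : U ∈ 𝓝 0) :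
    ∃ i, ∀ y, π X j i y = 0 → y ∈ U :=
  limit_nhds_of_isCofiltered (c := cone X j) (limit.isLimit _) hU

theorem isOpen_ker_π (j i : ℤ) : IsOpen ((π X j i).ker : Set (((proLim k).obj X).obj j)) :=
  isOpen_ker_coneProj (cone X j) i

variable (hX : IsAdmissibleBiFun _ X)

include hX

theorem π_surjective (j i : ℤ) : Function.Surjective (π X j i) :=
  limit_surjective (c := cone X j) (limit.isLimit _)
    (fun f => hX.surjective_of_eq ((extendIdx.obj j).map f) rfl) i

/-- Only components with `i ≤ j` need testing; there both first indices are `i`, and the transition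
maps are injective. -/
theorem map_injective {j j' : ℤ} (h : j ⟶ j') :
    Function.Injective (((proLim k).obj X).map h).hom := by
  rw [injective_iff_map_eq_zero]
  intro y hy
  refine ext_of_le j fun i hi => hX.injective_of_eq (TateIdx.hom (min_le_right i j)
    (min_le_right i j') (min_le_min_left i (leOfHom h)) (leOfHom h)) ?_ ?_
  · change min i j = min i j'
    have := leOfHom h
    omega
  · rw [← π_map, hy, map_zero, map_zero]

theorem π_map_eq_zero {j j' : ℤ} (h : j ⟶ j') (z : ((proLim k).obj X).obj j) :
    π X j' j ((((proLim k).obj X).map h).hom z) = 0 := by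
  rw [π_map, hX.eq_zero_of_eq (min_self j) (π X j j z), map_zero]

/-- Left exactness of the limit: each component of `y` lifts by exactness, and injectivity of the
transition maps makes the lifts compatible. -/
theorem exists_map_eq {j m : ℤ} (h : m ⟶ j) (y : ((proLim k).obj X).obj j) (hy : π X j m y = 0) :
    ∃ z, (((proLim k).obj X).map h).hom z = y := by
  have hmj := leOfHom h
  have h1 : ∀ i, min i m ≤ min (min i m) j := fun i => by omega
  choose e he using fun i => hX.exists_of_map_eq_zero
    (TateIdx.hom (min_le_right i m) (min_le_right (min i m) j) (h1 i) hmj)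
    (TateIdx.hom (min_le_right (min i m) j) (min_le_right m j)
      (min_le_min_right j (min_le_right i m)) le_rfl)
    (by change min i m = min (min i m) j; omega) (by change m = min m j; omega) rfl
    (π X j (min i m) y) ((map_π (min_le_right i m) y).trans hy)
  obtain ⟨z, hz⟩ := exists_π_eq e fun i i' hii' => by
    refine hX.injective_of_eq
      (TateIdx.hom (min_le_right i' m) (min_le_right (min i' m) j) (h1 i') hmj)
      (by change min i' m = min (min i' m) j; omega) ?_
    rw [he i', ← map_π (min_le_min_right m hii') y, ← he i, TateIdx.map_map X _ _ (TateIdx.hom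
      (min_le_right i m) (min_le_right (min i' m) j) (by omega) hmj), TateIdx.map_map X]
  refine ⟨z, sub_eq_zero.1 (ext_of_le m fun i _ => ?_)⟩
  rw [map_sub, sub_eq_zero, π_map, hz, ← map_π (min_le_left i m) y, ← he i, TateIdx.map_map X]

end proLim

namespace indProLim

open proLim

variable (X : TateIdx ⥤ FGModuleCat.{u} k)

/-- The canonical morphism from `lim_i X_{ij}` to `colim_j lim_i X_{ij}`. -/
noncomputable def ι (j : ℤ) : ((proLim k).obj X).obj j ⟶ (indProLim k).obj X :=
  colimit.ι ((proLim k).obj X) j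

theorem ι_map {j j' : ℤ} (h : j ⟶ j') (y : ((proLim k).obj X).obj j) :
    (ι X j').hom ((((proLim k).obj X).map h).hom y) = (ι X j).hom y :=
  congrArg (fun g => g.hom y) (colimit.w ((proLim k).obj X) h)

theorem map_ι {X Y : TateIdx ⥤ FGModuleCat.{u} k} (f : X ⟶ Y) (j : ℤ)
    (y : ((proLim k).obj X).obj j) :
    ((indProLim k).map f).hom ((ι X j).hom y) = (ι Y j).hom ((((proLim k).map f).app j).hom y) :=
  congrArg (fun g => g.hom y) (ι_colimMap ((proLim k).map f) j)

theorem exists_ι_eq (x : (indProLim k).obj X) : ∃ j y, (ι X j).hom y = x :=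
  TopModuleCat.isColimit_exists_rep (colimit.isColimit ((proLim k).obj X)) x

/-- The image of `lim_i X_{ij}` in `colim_j lim_i X_{ij}`. -/
noncomputable def filtration (j : ℤ) : Submodule k ((indProLim k).obj X) :=
  LinearMap.range (ι X j).hom.toLinearMap

theorem filtration_mono : Monotone (filtration X) := by
  rintro j j' h _ ⟨y, rfl⟩
  exact ⟨_, ι_map X (homOfLE h) y⟩

variable {X} (hX : IsAdmissibleBiFun _ X)

include hX

theorem ι_injective (j : ℤ) : Function.Injective (ι X j).hom :=
  TopModuleCat.isColimit_injective (colimit.isColimit ((proLim k).obj X))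
    (fun f => map_injective hX f) j

/-- This turns every question about the filtration on the colimit into one about projections from a
single stage. For `i ≤ j` it is exactness in the limit; for `j ≤ i` both sides always hold, since
`X_{jj} = 0`. -/
theorem ι_mem_filtration_iff {j i : ℤ} (y : ((proLim k).obj X).obj j) :
    (ι X j).hom y ∈ filtration X i ↔ π X j i y = 0 := by
  obtain hij | hji := le_total i j
  · constructor
    · rintro ⟨z, hz⟩
      obtain rfl : (((proLim k).obj X).map (homOfLE hij)).hom z = y :=
        ι_injective hX j ((ι_map X _ z).trans hz)
      exact π_map_eq_zero hX _ z
    · intro h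
      obtain ⟨z, rfl⟩ := exists_map_eq hX (homOfLE hij) y h
      exact ⟨z, (ι_map X _ z).symm⟩
  · exact ⟨fun _ => hX.eq_zero_of_eq (min_eq_right hji) _, fun _ =>
      filtration_mono X hji ⟨y, rfl⟩⟩

/-- No description of the colimit topology is needed: the quotient map to the discrete quotient is
continuous on each stage, hence on the colimit by the universal property, and the filtration step is
its kernel. -/
theorem isOpen_filtration (m : ℤ) : IsOpen (filtration X m : Set ((indProLim k).obj X)) := by
  let Q := (indProLim k).obj X ⧸ filtration X m
  let _ : TopologicalSpace Q := ⊥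
  have : DiscreteTopology Q := ⟨rfl⟩
  have : ContinuousSMul k Q := ⟨continuous_of_discreteTopology⟩
  have hcont : ∀ j, Continuous ((filtration X m).mkQ ∘ₗ (ι X j).hom.toLinearMap) := fun j => by
    refine continuous_of_continuousAt_zero ((filtration X m).mkQ ∘ₗ (ι X j).hom.toLinearMap) ?_
    rw [ContinuousAt, map_zero, nhds_discrete Q, Filter.tendsto_pure]
    refine Filter.mem_of_superset ((isOpen_ker_π (X := X) j m).mem_nhds (zero_mem _)) fun y hy => ?_
    exact (Submodule.Quotient.mk_eq_zero _).2 ((ι_mem_filtration_iff hX y).2 hy)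
  let s : Cocone ((proLim k).obj X) :=
    { pt := TopModuleCat.of k Q
      ι :=
        { app := fun j => ConcreteCategory.ofHom (C := TopModuleCat k)
            (Y := TopModuleCat.of k Q)
            ⟨(filtration X m).mkQ ∘ₗ (ι X j).hom.toLinearMap, hcont j⟩
          naturality := fun j j' f => by
            refine ConcreteCategory.hom_ext _ _ fun y => ?_
            exact congrArg (filtration X m).mkQ (ι_map X f y) } }
  let d : (indProLim k).obj X ⟶ TopModuleCat.of k Q := colimit.desc ((proLim k).obj X) s
  have hd : ∀ x, d.hom x = (filtration X m).mkQ x := fun x => by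
    obtain ⟨j, y, rfl⟩ := exists_ι_eq X x
    exact congrArg (fun g => g.hom y) (colimit.ι_desc s j)
  have h0 : IsOpen (d.hom ⁻¹' ({0} : Set Q)) := (isOpen_discrete _).preimage d.hom.continuous
  convert h0 using 1
  ext x
  rw [Set.mem_preimage, hd, Set.mem_singleton_iff]
  exact (Submodule.Quotient.mk_eq_zero _).symm

/-- Continuity of `ι X 0` is enough, because the steps of nonpositive index already lie in the image
of stage `0`. -/
theorem exists_filtration_subset {U : Set ((indProLim k).obj X)} (hU : U ∈ 𝓝 0) :
    ∃ j, (filtration X j : Set ((indProLim k).obj X)) ⊆ U := by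
  have h : (ι X 0).hom ⁻¹' U ∈ 𝓝 0 :=
    (ι X 0).hom.continuous.continuousAt.preimage_mem_nhds (by rwa [map_zero])
  obtain ⟨i, hi⟩ := exists_forall_mem_of_nhds h
  refine ⟨min i 0, ?_⟩
  intro x hx
  obtain ⟨y, rfl⟩ := filtration_mono X (min_le_right i 0) hx
  exact hi y ((ι_mem_filtration_iff hX y).1 (filtration_mono X (min_le_left i 0) hx))

theorem filtration_separated (x : (indProLim k).obj X) (hx : ∀ j, x ∈ filtration X j) : x = 0 := by
  obtain ⟨y, rfl⟩ := hx 0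
  rw [ext_of_le (X := X) (j := 0) 0 (y := y) fun i _ => (ι_mem_filtration_iff hX y).1 (hx i), map_zero]

theorem filtration_complete (v : ℤ → (indProLim k).obj X)
    (hv : ∀ i i', i ≤ i' → v i - v i' ∈ filtration X i') : ∃ x, ∀ i, x - v i ∈ filtration X i := by
  -- One stage `j ≥ 0` contains every `v (min i 0)`, so the limit can be formed there; replacing `v
  -- i` by `v (min i 0)` changes it only by an element of step `i`.
  obtain ⟨j, hj0, hj⟩ : ∃ j, 0 ≤ j ∧ v 0 ∈ filtration X j := by
    obtain ⟨j, y, hy⟩ := exists_ι_eq X (v 0)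
    exact ⟨max j 0, le_max_right _ _, filtration_mono X (le_max_left _ _) ⟨y, hy⟩⟩
  have h1 : ∀ i, v (min i 0) ∈ filtration X j := fun i => by
    simpa using add_mem (filtration_mono X hj0 (hv _ _ (min_le_right i 0))) hj
  choose y hy using h1
  replace hy : ∀ i, (ι X j).hom (y i) = v (min i 0) := hy
  obtain ⟨z, hz⟩ := exists_π_eq (X := X) (fun i => π X j i (y i)) fun i i' h => by
    rw [map_π h, ← sub_eq_zero, ← map_sub, ← ι_mem_filtration_iff hX, map_sub, hy, hy]
    exact filtration_mono X (min_le_left _ _) (hv _ _ (min_le_min_right 0 h))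
  refine ⟨(ι X j).hom z, fun i => ?_⟩
  have h2 : (ι X j).hom z - v (min i 0) ∈ filtration X i := by
    rw [← hy, ← map_sub, ι_mem_filtration_iff hX, map_sub, hz, sub_self]
  simpa using add_mem h2 (hv _ _ (min_le_left i 0))

/-- The coordinates of the elements of the filtration. -/
noncomputable def proj (q : TateIdx) : filtration X q.1.2 →ₗ[k] X.obj q :=
  (X.map (toIdx q)).hom.hom ∘ₗ π X q.1.2 q.1.1 ∘ₗ
    (LinearEquiv.ofInjective (ι X q.1.2).hom.toLinearMap (ι_injective hX q.1.2)).symm.toLinearMap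

theorem proj_ι (q : TateIdx) (y : ((proLim k).obj X).obj q.1.2)
    (h : (ι X q.1.2).hom y ∈ filtration X q.1.2) :
    proj hX q ⟨(ι X q.1.2).hom y, h⟩ = (X.map (toIdx q)).hom.hom (π X q.1.2 q.1.1 y) := by
  have : (LinearEquiv.ofInjective (ι X q.1.2).hom.toLinearMap (ι_injective hX q.1.2)).symm
      ⟨(ι X q.1.2).hom y, h⟩ = y := by
    rw [LinearEquiv.symm_apply_eq]
    rfl
  exact congrArg (fun z => (X.map (toIdx q)).hom.hom (π X q.1.2 q.1.1 z)) this

/-- The canonical realization of an admissible functor. -/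
noncomputable def realization : TateRealization X ((indProLim k).obj X) where
  L := filtration X
  mono := filtration_mono X
  isOpen := isOpen_filtration hX
  exists_le _ := exists_filtration_subset hX
  exists_mem x := by
    obtain ⟨j, y, hy⟩ := exists_ι_eq X x
    exact ⟨j, y, hy⟩
  separated := filtration_separated hX
  complete := filtration_complete hX
  proj := proj hX
  proj_surjective q e := by
    obtain ⟨e', rfl⟩ := hX.surjective_of_eq (toIdx q) rfl e
    obtain ⟨y, rfl⟩ := π_surjective hX q.1.2 q.1.1 e'
    exact ⟨_, proj_ι hX q y ⟨y, rfl⟩⟩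
  proj_eq_zero_iff := by
    rintro q ⟨_, y, rfl⟩
    refine Iff.trans (Eq.congr_left (proj_ι hX q y ⟨y, rfl⟩)) ?_
    refine Iff.trans ?_ (ι_mem_filtration_iff hX y).symm
    exact map_eq_zero_iff _ (hX.injective_of_eq (toIdx q) (min_eq_left q.2))
  map_proj := by
    rintro q q' f ⟨_, y, rfl⟩
    have h1 := proj_ι hX q y ⟨y, rfl⟩
    have h2 := proj_ι hX q' _ ⟨((((proLim k).obj X).map (homOfLE (leOfHom f).2)).hom y), rfl⟩
    refine (congrArg _ h1).trans (Eq.trans ?_ (h2.symm.trans (congrArg _ (Subtype.ext ?_))))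
    · rw [π_map, ← map_π (leOfHom f).1, TateIdx.map_map X _ _ (toIdx q ≫ f),
        TateIdx.map_map X _ _ (TateIdx.hom (min_le_right q.1.1 q.1.2) (min_le_right q'.1.1 q'.1.2)
          (min_le_min (leOfHom f).1 (leOfHom f).2) (leOfHom f).2), TateIdx.map_map X]
    · exact ι_map X _ y

omit hX in
theorem compat_map {X Y : TateIdx ⥤ FGModuleCat.{u} k} (hX : IsAdmissibleBiFun _ X)
    (hY : IsAdmissibleBiFun _ Y) (f : X ⟶ Y) :
    (realization hX).Compat (realization hY) f ((indProLim k).map f) := by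
  rintro q ⟨_, y, rfl⟩
  have h : ((indProLim k).map f).hom ((ι X q.1.2).hom y) ∈ filtration Y q.1.2 :=
    ⟨_, (map_ι f q.1.2 y).symm⟩
  refine ⟨h, ?_⟩
  refine Eq.trans (congrArg (proj hY q) (Subtype.ext (map_ι f q.1.2 y) :
    (⟨_, h⟩ : filtration Y q.1.2) = ⟨_, ⟨_, rfl⟩⟩)) ?_
  refine (proj_ι hY q _ _).trans (Eq.trans ?_ (congrArg (f.app q).hom.hom (proj_ι hX q y ⟨y, rfl⟩)).symm)
  rw [π_app]
  exact congrArg (fun g => g.hom.hom (π X q.1.2 q.1.1 y)) (f.naturality (toIdx q)).symm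

end indProLim

end ProLim

/-! ### Filtrations on locally linearly compact spaces -/

section Chains

variable {k : Type u} [Field k]

section QuotientFunctor

variable {V : Type u} [AddCommGroup V] [Module k V] {L : ℤ → Submodule k V} (hL : Monotone L)
  (hfin : ∀ i j, i ≤ j → Module.Finite k (L j ⧸ (L i).submoduleOf (L j)))

/-- The functor `(i, j) ↦ L j / L i` attached to a filtration. -/
def filtrationQuotient : TateIdx ⥤ FGModuleCat.{u} k where
  obj q := ⟨ModuleCat.of k (L q.1.2 ⧸ (L q.1.1).submoduleOf (L q.1.2)), hfin _ _ q.2⟩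
  map {q q'} f := ObjectProperty.homMk (ModuleCat.ofHom
    (Submodule.mapQ _ _ (Submodule.inclusion (hL (leOfHom f).2)) fun _ hx => hL (leOfHom f).1 hx))
  map_id q := FGModuleCat.hom_ext (LinearMap.ext fun x => by
    obtain ⟨x, rfl⟩ := Submodule.mkQ_surjective _ x
    rfl)
  map_comp f g := FGModuleCat.hom_ext (LinearMap.ext fun x => by
    obtain ⟨x, rfl⟩ := Submodule.mkQ_surjective _ x
    rfl)

theorem mkQ_submoduleOf_eq_zero_iff {A B : Submodule k V} (x : B) :
    (A.submoduleOf B).mkQ x = 0 ↔ (x : V) ∈ A :=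
  Submodule.Quotient.mk_eq_zero _

theorem isAdmissible_filtrationQuotient :
    IsAdmissibleBiFun _ (filtrationQuotient hL hfin) := by
  intro i j l hij hjl
  refine ⟨FGModuleCat.hom_ext (LinearMap.ext fun x => ?_), FGModuleCat.shortExact_iff.2
    ⟨?_, fun x => ?_, fun x hx => ?_⟩⟩
  · obtain ⟨x, rfl⟩ := Submodule.mkQ_surjective _ x
    exact (mkQ_submoduleOf_eq_zero_iff (A := L j) (B := L l) ⟨x, hL hjl x.2⟩).2 x.2
  · rw [injective_iff_map_eq_zero]
    intro x hx
    obtain ⟨x, rfl⟩ := Submodule.mkQ_surjective _ x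
    exact (mkQ_submoduleOf_eq_zero_iff (A := L i) (B := L j) x).2
      ((mkQ_submoduleOf_eq_zero_iff (A := L i) (B := L l) ⟨x, hL hjl x.2⟩).1 hx)
  · obtain ⟨x, rfl⟩ := Submodule.mkQ_surjective _ x
    exact ⟨((L i).submoduleOf (L l)).mkQ x, rfl⟩
  · obtain ⟨x, rfl⟩ := Submodule.mkQ_surjective _ x
    have hxj : (x : V) ∈ L j := (mkQ_submoduleOf_eq_zero_iff (A := L j) (B := L l) x).1 hx
    exact ⟨((L i).submoduleOf (L j)).mkQ ⟨x, hxj⟩, rfl⟩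

end QuotientFunctor

theorem Submodule.finite_quotient_submoduleOf {V : Type*} [AddCommGroup V] [Module k V]
    {A B : Submodule k V} (h : (A.map B.mkQ).FG) : Module.Finite k (A ⧸ B.submoduleOf A) := by
  have : Module.Finite k (A.map B.mkQ) := Module.Finite.iff_fg.2 h
  let f : (A ⧸ B.submoduleOf A) →ₗ[k] V ⧸ B := Submodule.mapQ _ _ A.subtype le_rfl
  have hf : ∀ x, f x ∈ A.map B.mkQ := fun x => by
    obtain ⟨x, rfl⟩ := Submodule.mkQ_surjective _ x
    exact ⟨x, x.2, rfl⟩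
  refine Module.Finite.of_injective (f.codRestrict _ hf) ?_
  rw [injective_iff_map_eq_zero]
  intro x hx
  obtain ⟨x, rfl⟩ := Submodule.mkQ_surjective _ x
  exact (Submodule.Quotient.mk_eq_zero _).2
    ((Submodule.Quotient.mk_eq_zero B).1 (congrArg Subtype.val hx) : (x : V) ∈ B)

theorem IsLinearlyCompact.map_mkQ_fg {V : Type*} [AddCommGroup V] [Module k V] [TopologicalSpace V]
    [IsTopologicalAddGroup V] {U B : Submodule k V} (hU : IsLinearlyCompact k U)
    (hB : IsOpen (B : Set V)) : (U.map B.mkQ).FG := by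
  have : Module.Finite k (U ⧸ B.submoduleOf U) :=
    hU.finite_quotient _ (hB.preimage continuous_subtype_val)
  let f : (U ⧸ B.submoduleOf U) →ₗ[k] V ⧸ B := Submodule.mapQ _ _ U.subtype le_rfl
  have hf : U.map B.mkQ = f.range := by
    ext y
    constructor
    · rintro ⟨x, hx, rfl⟩
      exact ⟨(B.submoduleOf U).mkQ ⟨x, hx⟩, rfl⟩
    · rintro ⟨x, rfl⟩
      obtain ⟨x, rfl⟩ := Submodule.mkQ_surjective _ x
      exact ⟨x, x.2, rfl⟩
  rw [hf, ← Module.Finite.iff_fg]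
  infer_instance

/-- A topological vector space whose neighbourhood filter of zero is countably generated and has a
basis of subspaces admits a sequence of open subspaces that is a neighbourhood basis of zero. -/
theorem exists_seq_open_submodule {V : Type*} [AddCommGroup V] [Module k V] [TopologicalSpace V]
    [IsTopologicalAddGroup V] (hlin : IsLinearTopology k V)
    (hc : (𝓝 (0 : V)).IsCountablyGenerated) :
    ∃ W : ℕ → Submodule k V, (∀ n, IsOpen (W n : Set V)) ∧ ∀ U ∈ 𝓝 (0 : V), ∃ n, (W n : Set V) ⊆ U := by
  obtain ⟨x, hx⟩ := (𝓝 (0 : V)).exists_antitone_basis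
  choose W hW hWx using fun n =>
    (IsLinearTopology.hasBasis_open_submodule k).mem_iff.1 (hx.toHasBasis.mem_of_mem (i := n) trivial)
  refine ⟨W, hW, fun U hU => ?_⟩
  obtain ⟨n, -, hn⟩ := hx.toHasBasis.mem_iff.1 hU
  exact ⟨n, (hWx n).trans hn⟩

variable [TopologicalSpace k]

/-- A filtration by open subspaces gives a realization if `L 0` is linearly compact and the
subquotients are finite-dimensional. -/
noncomputable def TateRealization.ofFiltration (V : TopModuleCat.{u} k) [T2Space V]
    {L : ℤ → Submodule k V} (hL : Monotone L) (hopen : ∀ j, IsOpen (L j : Set V))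
    (hfin : ∀ i j, i ≤ j → Module.Finite k (L j ⧸ (L i).submoduleOf (L j)))
    (hle : ∀ U ∈ 𝓝 (0 : V), ∃ j, (L j : Set V) ⊆ U) (hmem : ∀ x, ∃ j, x ∈ L j)
    (h0 : IsLinearlyCompact k (L 0)) : TateRealization (filtrationQuotient hL hfin) V where
  L := L
  mono := hL
  isOpen := hopen
  exists_le := hle
  exists_mem := hmem
  separated x hx := by
    by_contra h
    obtain ⟨j, hj⟩ := hle {x}ᶜ (isOpen_compl_singleton.mem_nhds (Ne.symm h))
    exact hj (hx j) rfl
  complete v hv := by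
    -- Linear compactness of `L 0` is applied to the differences `v i - v 0` for `i ≤ 0`; the cosets
    -- of a finite set of indices meet at the difference for a smaller index. Positive indices then
    -- follow from index `0`.
    obtain ⟨y, hy⟩ := h0.exists_sub_mem (fun i : Set.Iic (0 : ℤ) => (L i).submoduleOf (L 0))
      (fun i => (hopen i).preimage continuous_subtype_val) (fun i => ⟨v i - v 0, hv i 0 i.2⟩)
      (fun S => by
        obtain ⟨m, hm⟩ : ∃ m : Set.Iic (0 : ℤ), ∀ i ∈ S, m ≤ i :=
          have : Nonempty (Set.Iic (0 : ℤ))ᵒᵈ := ⟨⟨0, Set.mem_Iic.2 le_rfl⟩⟩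
          Finset.exists_le (α := (Set.Iic (0 : ℤ))ᵒᵈ) S
        refine ⟨⟨v m - v 0, hv m 0 m.2⟩, fun i hi => ?_⟩
        change v m - v 0 - (v i - v 0) ∈ L i
        rw [sub_sub_sub_cancel_right]
        exact hv m i (hm i hi))
    have hy' : ∀ i ≤ 0, (y : V) + v 0 - v i ∈ L i := fun i hi => by
      have : (y : V) - (v i - v 0) ∈ L i := hy ⟨i, hi⟩
      rwa [sub_sub_eq_add_sub] at this
    refine ⟨y + v 0, fun i => ?_⟩
    obtain hi | hi := le_total i 0
    · exact hy' i hi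
    · simpa [add_sub_assoc] using add_mem (hL hi (hy' 0 le_rfl)) (hv 0 i hi)
  proj q := ((L q.1.1).submoduleOf (L q.1.2)).mkQ
  proj_surjective q := Submodule.mkQ_surjective _
  proj_eq_zero_iff q x := mkQ_submoduleOf_eq_zero_iff x
  map_proj f x := rfl

/-- The filtration grows upwards by sums of the covering linearly compact subspaces and shrinks
downwards by intersections with a countable neighbourhood basis. -/
theorem exists_tateRealization (V : TopModuleCat.{u} k) (hV : countableLLCProp k V) :
    ∃ X, IsAdmissibleBiFun _ X ∧ Nonempty (TateRealization X V) := by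
  obtain ⟨⟨ht2, hlin, -⟩, hc, U, hU, hUx⟩ := hV
  obtain ⟨W, hW, hWU⟩ := exists_seq_open_submodule hlin hc
  let A : ℕ → Submodule k V := fun n => (Finset.range (n + 1)).sup U
  let B : ℕ → Submodule k V := fun n => (Finset.range n).inf W
  have hA : Monotone A := fun m n h => Finset.sup_mono (by simpa using h)
  have hB : Antitone B := fun m n h => Finset.inf_mono (by simpa using h)
  have hAopen : ∀ n, IsOpen (A n : Set V) := fun n =>
    Submodule.isOpen_mono (Finset.le_sup (f := U) (Finset.mem_range.2 n.succ_pos)) (hU 0).1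
  have hBopen : ∀ n, IsOpen (B n : Set V) := fun n => by
    refine Finset.inf_induction (p := fun P : Submodule k V => IsOpen (P : Set V)) isOpen_univ
      (fun P hP Q hQ => hP.inter hQ) fun i _ => hW i
  -- One of the two indices is always `0`. As `B 0` is an empty intersection and `A 0 = U 0`, step
  -- `0` is exactly `U 0`.
  let L : ℤ → Submodule k V := fun j => A j.toNat ⊓ B (-j).toNat
  have hL : Monotone L := fun i j h => inf_le_inf (hA (by omega)) (hB (by omega))
  have hLopen : ∀ j, IsOpen (L j : Set V) := fun j => (hAopen _).inter (hBopen _)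
  have hL0 : L 0 = U 0 := by simp [L, A, B]
  -- `A n` is a finite sum of linearly compact subspaces, each with finite-dimensional image modulo
  -- the open `L i`.
  have hfin : ∀ i j, i ≤ j → Module.Finite k (L j ⧸ (L i).submoduleOf (L j)) := fun i j _ => by
    refine Submodule.finite_quotient_submoduleOf (Submodule.FG.of_le (T := (A j.toNat).map (L i).mkQ) ?_
      (Submodule.map_mono inf_le_left))
    refine Finset.sup_induction (p := fun P : Submodule k V => (P.map (L i).mkQ).FG) ?_ ?_ ?_
    · rw [Submodule.map_bot]
      exact Submodule.fg_bot
    · intro P hP Q hQ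
      rw [Submodule.map_sup]
      exact hP.sup hQ
    · exact fun n _ => (hU n).2.map_mkQ_fg (hLopen i)
  refine ⟨_, isAdmissible_filtrationQuotient hL hfin,
    ⟨TateRealization.ofFiltration V hL hLopen hfin (fun N hN => ?_) (fun x => ?_) ?_⟩⟩
  · obtain ⟨n, hn⟩ := hWU N hN
    refine ⟨-(n + 1 : ℕ), fun x hx => hn ?_⟩
    have h1 : x ∈ B (n + 1) := by simpa using hx.2
    exact Finset.inf_le (f := W) (Finset.self_mem_range_succ n) h1
  · obtain ⟨n, hn⟩ := hUx x
    refine ⟨n, ?_, by simp [B]⟩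
    exact Finset.le_sup (f := U) (Finset.mem_range.2 (by simp)) hn
  · rw [hL0]
    exact (hU 0).2

end Chains

/-! ### Fractions in the Beilinson category -/

section Roofs

/-- Take for `φ n` the greatest `m ≤ n` with `R m n`. Maximality gives monotonicity and the limit at
`+∞`; the bound by `n` gives the limit at `-∞`. -/
theorem Bicofinal.exists_of_rel (R : ℤ → ℤ → Prop)
    (hR : ∀ {m m' n n'}, m' ≤ m → n ≤ n' → R m n → R m' n') (h₁ : ∀ n, ∃ m, R m n)
    (h₂ : ∀ m, ∃ n, R m n) : ∃ φ : Bicofinal, (∀ n, φ.toFun n ≤ n) ∧ ∀ n, R (φ.toFun n) n := by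
  have key : ∀ n, ∃ m, (m ≤ n ∧ R m n) ∧ ∀ z, z ≤ n ∧ R z n → z ≤ m := fun n => by
    refine Int.exists_greatest_of_bdd (P := fun m => m ≤ n ∧ R m n) ⟨n, fun z hz => hz.1⟩ ?_
    obtain ⟨m, hm⟩ := h₁ n
    exact ⟨min m n, min_le_right _ _, hR (min_le_left _ _) le_rfl hm⟩
  choose f hf hmax using key
  refine ⟨⟨⟨f, fun n n' h => hmax n' _ ⟨(hf n).1.trans h, hR le_rfl h (hf n).2⟩⟩,
    Filter.tendsto_atBot_mono (fun n => (hf n).1) Filter.tendsto_id, ?_⟩,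
    fun n => (hf n).1, fun n => (hf n).2⟩
  refine Filter.tendsto_atTop.2 fun b => ?_
  obtain ⟨n, hn⟩ := h₂ b
  filter_upwards [Filter.eventually_ge_atTop (max b n)] with n' hn'
  exact hmax n' b ⟨(le_max_left _ _).trans hn', hR le_rfl ((le_max_right _ _).trans hn') hn⟩

/-- The identity of `ℤ`. -/
noncomputable def Bicofinal.id : Bicofinal := ⟨OrderHom.id, Filter.tendsto_id, Filter.tendsto_id⟩

/-- The composition `φ ∘ ψ`. -/
noncomputable def Bicofinal.comp (φ ψ : Bicofinal) : Bicofinal :=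
  ⟨φ.toOrderHom.comp ψ.toOrderHom, φ.tendsto_atBot.comp ψ.tendsto_atBot,
    φ.tendsto_atTop.comp ψ.tendsto_atTop⟩

theorem Bicofinal.comp_le {φ ψ : Bicofinal} (hφ : ∀ n, φ.toFun n ≤ n) (hψ : ∀ n, ψ.toFun n ≤ n)
    (n : ℤ) : (φ.comp ψ).toFun n ≤ n := (hφ _).trans (hψ n)

theorem Bicofinal.comp_le_right {φ : Bicofinal} (hφ : ∀ n, φ.toFun n ≤ n) (ψ : Bicofinal) (n : ℤ) :
    (φ.comp ψ).toFun n ≤ ψ.toFun n := hφ _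

variable {A : Type u} [Category.{v} A] [HasZeroMorphisms A]

namespace AdmBiFun

/-- The functoriality of `X ∘ φ̃` in `X`. -/
noncomputable def reindexMap {X Y : AdmBiFun A} (f : X ⟶ Y) (φ : Bicofinal) :
    X.reindex φ ⟶ Y.reindex φ :=
  ObjectProperty.homMk (φ.tilde.whiskerLeft f.hom)

/-- The canonical morphism `X ∘ φ̃ ⟶ X` for `φ ≤ id`. -/
noncomputable def fromReindex (X : AdmBiFun A) (φ : Bicofinal) (h : ∀ n, φ.toFun n ≤ n) :
    X.reindex φ ⟶ X :=
  X.reindexHom (φ₁ := Bicofinal.id) h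

theorem beilinsonU_fromReindex (X : AdmBiFun A) (φ : Bicofinal) (h : ∀ n, φ.toFun n ≤ n) :
    beilinsonU A (X.fromReindex φ h) :=
  BeilinsonU.mk X φ Bicofinal.id h

instance (X : AdmBiFun A) (φ : Bicofinal) (h : ∀ n, φ.toFun n ≤ n) :
    IsIso ((beilinsonU A).Q.map (X.fromReindex φ h)) :=
  (beilinsonU A).Q_inverts _ (X.beilinsonU_fromReindex φ h)

theorem reindexMap_fromReindex {X Y : AdmBiFun A} (f : X ⟶ Y) (φ : Bicofinal)
    (h : ∀ n, φ.toFun n ≤ n) :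
    reindexMap f φ ≫ Y.fromReindex φ h = X.fromReindex φ h ≫ f :=
  ObjectProperty.hom_ext _ (NatTrans.ext (funext fun p =>
    (f.hom.naturality (TateIdx.hom (φ.monotone' p.2) p.2 (h p.1.1) (h p.1.2))).symm))

theorem reindexHom_comp (X : AdmBiFun A) {φ₀ φ₁ φ₂ : Bicofinal}
    (h : ∀ n, φ₀.toFun n ≤ φ₁.toFun n) (h' : ∀ n, φ₁.toFun n ≤ φ₂.toFun n) :
    X.reindexHom h ≫ X.reindexHom h' = X.reindexHom fun n => (h n).trans (h' n) :=
  ObjectProperty.hom_ext _ (NatTrans.ext (funext fun _ => (X.obj.map_comp _ _).symm))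

/-- The identification of `X ∘ (φ ∘ ψ)~` with `(X ∘ φ̃) ∘ ψ̃`. -/
noncomputable def reindexComp (X : AdmBiFun A) (φ ψ : Bicofinal) :
    X.reindex (φ.comp ψ) ⟶ (X.reindex φ).reindex ψ :=
  𝟙 (X.reindex (φ.comp ψ))

theorem reindexComp_fromReindex (X : AdmBiFun A) (φ ψ : Bicofinal) (hφ : ∀ n, φ.toFun n ≤ n)
    (hψ : ∀ n, ψ.toFun n ≤ n) :
    X.reindexComp φ ψ ≫ (X.reindex φ).fromReindex ψ hψ ≫ X.fromReindex φ hφ =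
      X.fromReindex (φ.comp ψ) (Bicofinal.comp_le hφ hψ) :=
  (Category.id_comp _).trans
    (ObjectProperty.hom_ext _ (NatTrans.ext (funext fun _ => (X.obj.map_comp _ _).symm)))

/-- A morphism in the Beilinson category is a right fraction `s⁻¹ ≫ f`, where
`s : X ∘ φ̃ ⟶ X` is the canonical morphism for some `φ ≤ id`. -/
def IsRoof {X Y : AdmBiFun A} (a : (beilinsonU A).Q.obj X ⟶ (beilinsonU A).Q.obj Y) : Prop :=
  ∃ (φ : Bicofinal) (h : ∀ n, φ.toFun n ≤ n) (f : X.reindex φ ⟶ Y),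
    (beilinsonU A).Q.map (X.fromReindex φ h) ≫ a = (beilinsonU A).Q.map f

theorem isRoof_map {X Y : AdmBiFun A} (f : X ⟶ Y) : IsRoof ((beilinsonU A).Q.map f) :=
  ⟨Bicofinal.id, fun _ => le_rfl, X.fromReindex _ _ ≫ f, ((beilinsonU A).Q.map_comp _ _).symm⟩

/-- The Ore condition holds because `fromReindex` is natural: the denominator of `b` moves past `f`
once `f` is reindexed. -/
theorem IsRoof.comp {X Y Z : AdmBiFun A} {a : (beilinsonU A).Q.obj X ⟶ (beilinsonU A).Q.obj Y}
    {b : (beilinsonU A).Q.obj Y ⟶ (beilinsonU A).Q.obj Z} (ha : IsRoof a) (hb : IsRoof b) :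
    IsRoof (a ≫ b) := by
  obtain ⟨φ, hφ, f, hf⟩ := ha
  obtain ⟨ψ, hψ, g, hg⟩ := hb
  refine ⟨φ.comp ψ, Bicofinal.comp_le hφ hψ, X.reindexComp φ ψ ≫ reindexMap f ψ ≫ g, ?_⟩
  rw [← reindexComp_fromReindex X φ ψ hφ hψ]
  simp only [Functor.map_comp, Category.assoc]
  rw [reassoc_of% hf, ← hg, ← Functor.map_comp_assoc _ (reindexMap f ψ), reindexMap_fromReindex,
    Functor.map_comp_assoc]

/-- With `φ₁ ∘ ψ ≤ φ₀`, structure maps go from `Z ∘ φ₁ ∘ ψ` to `Z ∘ φ₀`, and continuing to `Z ∘ φ₁`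
gives the canonical denominator. -/
theorem isRoof_inv {X Y : AdmBiFun A} (w : X ⟶ Y) (hw : beilinsonU A w) :
    IsRoof (Localization.Construction.wInv w hw) := by
  obtain ⟨Z, φ₀, φ₁, h⟩ := hw
  obtain ⟨ψ, hψ, hR⟩ := Bicofinal.exists_of_rel (fun m n => φ₁.toFun m ≤ φ₀.toFun n)
    (fun hm hn h => (φ₁.monotone' hm).trans (h.trans (φ₀.monotone' hn)))
    (fun n => φ₁.exists_apply_le _) (fun m => φ₀.exists_le_apply _)
  have hR' : ∀ n, (φ₁.comp ψ).toFun n ≤ φ₀.toFun n := hR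
  let f : (Z.reindex φ₁).reindex ψ ⟶ Z.reindex φ₀ := Z.reindexHom hR'
  have hf : f ≫ Z.reindexHom h = (Z.reindex φ₁).fromReindex ψ hψ := Z.reindexHom_comp hR' h
  refine ⟨ψ, hψ, f, ?_⟩
  rw [Iso.comp_inv_eq, ← hf]
  exact (beilinsonU A).Q.map_comp _ _

/-- The localization is generated under composition by images of morphisms and formal inverses,
which are all such fractions. -/
theorem isRoof {X Y : AdmBiFun A} (a : (beilinsonU A).Q.obj X ⟶ (beilinsonU A).Q.obj Y) :
    IsRoof a := by
  let P : MorphismProperty (BeilinsonCat A) := fun B C b =>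
    IsRoof (X := (Localization.Construction.objEquiv _).symm B)
      (Y := (Localization.Construction.objEquiv _).symm C) b
  have : P.IsStableUnderComposition := ⟨fun _ _ ha hb => IsRoof.comp ha hb⟩
  have hP := Localization.Construction.morphismProperty_eq_top P (fun _ _ f => isRoof_map f)
    (fun _ _ w hw => isRoof_inv w hw)
  have : P a := by
    rw [hP]
    trivial
  exact this

/-- Two morphisms of the Beilinson category are fractions with a common denominator. -/
theorem exists_roofs {X Y : AdmBiFun A} (a b : (beilinsonU A).Q.obj X ⟶ (beilinsonU A).Q.obj Y) :
    ∃ (φ : Bicofinal) (h : ∀ n, φ.toFun n ≤ n) (f g : X.reindex φ ⟶ Y),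
      (beilinsonU A).Q.map (X.fromReindex φ h) ≫ a = (beilinsonU A).Q.map f ∧
      (beilinsonU A).Q.map (X.fromReindex φ h) ≫ b = (beilinsonU A).Q.map g := by
  obtain ⟨φ, hφ, f, hf⟩ := isRoof a
  obtain ⟨ψ, hψ, g, hg⟩ := isRoof b
  -- As both maps are at most the identity, `φ ∘ ψ` refines the two denominators.
  refine ⟨φ.comp ψ, Bicofinal.comp_le hφ hψ,
    X.reindexComp φ ψ ≫ (X.reindex φ).fromReindex ψ hψ ≫ f,
    X.reindexHom (Bicofinal.comp_le_right hφ ψ) ≫ g, ?_, ?_⟩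
  · rw [← reindexComp_fromReindex X φ ψ hφ hψ]
    simp only [Functor.map_comp, Category.assoc, hf]
  · rw [Functor.map_comp, ← hg, ← Functor.map_comp_assoc]
    congr 2
    exact (X.reindexHom_comp (φ₂ := Bicofinal.id) (Bicofinal.comp_le_right hφ ψ) hψ).symm

end AdmBiFun

end Roofs

/-! ### The equivalence from Tate spaces to topological spaces -/

section TateFunctorEquivalence

variable {k : Type u} [Field k] [TopologicalSpace k]

namespace TateRealization

variable {X Y : TateIdx ⥤ FGModuleCat.{u} k} {V W : TopModuleCat.{u} k}

theorem compat_reindexHom {X : AdmBiFun (FGModuleCat.{u} k)} (R : TateRealization X.obj V)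
    {φ₀ φ₁ : Bicofinal} (h : ∀ n, φ₀.toFun n ≤ φ₁.toFun n) :
    (R.reindex φ₀).Compat (R.reindex φ₁) (X.reindexHom h).hom (𝟙 V) := fun q x =>
  ⟨R.mono (h _) x.2, (R.map_proj (TateIdx.hom (φ₀.monotone' q.2) (φ₁.monotone' q.2)
        (h q.1.1) (h q.1.2)) x).symm⟩

theorem compat_fromReindex {X : AdmBiFun (FGModuleCat.{u} k)} (R : TateRealization X.obj V)
    {φ : Bicofinal} (h : ∀ n, φ.toFun n ≤ n) :
    (R.reindex φ).Compat R (X.fromReindex φ h).hom (𝟙 V) := fun q x =>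
  ⟨R.mono (h _) x.2, (R.map_proj (TateIdx.hom (φ.monotone' q.2) q.2 (h q.1.1) (h q.1.2)) x).symm⟩

/-- Continuous linear maps between realizations respect the filtrations up to reindexing. -/
theorem exists_bicofinal (R : TateRealization X V) (S : TateRealization Y W) (g : V ⟶ W) :
    ∃ φ : Bicofinal, (∀ n, φ.toFun n ≤ n) ∧ ∀ n, ∀ x ∈ R.L (φ.toFun n), g.hom x ∈ S.L n := by
  have h₁ : ∀ n, ∃ m, ∀ x ∈ R.L m, g.hom x ∈ S.L n := fun n => by
    have h : g.hom ⁻¹' (S.L n) ∈ 𝓝 0 := g.hom.continuous.continuousAt.preimage_mem_nhds (by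
      rw [map_zero]
      exact (S.isOpen n).mem_nhds (zero_mem _))
    exact R.exists_le _ h
  refine Bicofinal.exists_of_rel (fun m n => ∀ x ∈ R.L m, g.hom x ∈ S.L n)
    (fun hm hn h x hx => S.mono hn (h x (R.mono hm hx))) h₁ fun m => ?_
  -- It remains to find `n` with `g (L m) ⊆ L n`. Some `L (min i m)` already maps into `L 0`, and
  -- modulo it `L m` is finite-dimensional, so the increasing images of the preimages of the `L n`
  -- stabilize.
  obtain ⟨i, hi⟩ := h₁ 0
  replace hi : ∀ x ∈ R.L (min i m), g.hom x ∈ S.L 0 := fun x hx => hi x (R.mono (min_le_left _ _) hx)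
  let q := TateIdx.mk (min i m) m (min_le_right i m)
  let N : ℕ →o Submodule k (X.obj q) :=
    ⟨fun n => ((S.L n).comap (g.hom.toLinearMap ∘ₗ (R.L m).subtype)).map (R.proj q), fun a b h =>
      Submodule.map_mono (Submodule.comap_mono (S.mono (Int.ofNat_le.2 h)))⟩
  obtain ⟨n, hn⟩ := monotone_stabilizes_iff_noetherian.2 (inferInstance : IsNoetherian k (X.obj q)) N
  refine ⟨n, fun x hx => ?_⟩
  obtain ⟨j, hj⟩ := S.exists_mem (g.hom x)
  have h1 : R.proj q ⟨x, hx⟩ ∈ N (max n j.toNat) :=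
    ⟨⟨x, hx⟩, S.mono (by push_cast; omega) hj, rfl⟩
  rw [← hn _ (le_max_left _ _)] at h1
  obtain ⟨z, hz, hzx⟩ := h1
  have h2 : (x : V) - z ∈ R.L (min i m) := (R.proj_eq_iff q ⟨x, hx⟩ z).1 hzx.symm
  have h3 := add_mem (S.mono (Int.natCast_nonneg n) (hi _ h2)) (show g.hom z ∈ S.L n from hz)
  rwa [← map_add, sub_add_cancel] at h3

end TateRealization

variable [DiscreteTopology k]

/-- The functor `(V_{ij}) ↦ colim_j lim_i V_{ij}` on admissible functors. -/
noncomputable def admLim : AdmBiFun (FGModuleCat.{u} k) ⥤ CountableLLCCat k :=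
  ObjectProperty.lift _ ((IsAdmissibleBiFun (FGModuleCat.{u} k)).ι ⋙ indProLim k)
    fun X => (indProLim.realization X.property).countableLLC

/-- Both reindexings are realized on the same space with the morphism acting as the identity;
uniqueness transports this to the canonical realizations. -/
theorem indProLim.map_reindexHom {X : AdmBiFun (FGModuleCat.{u} k)} {φ₀ φ₁ : Bicofinal}
    (h : ∀ n, φ₀.toFun n ≤ φ₁.toFun n) : IsIso ((indProLim k).map (X.reindexHom h).hom) := by
  let R := realization X.property
  obtain ⟨e₀, h₀, -⟩ := (realization (X.reindex φ₀).property).exists_iso (R.reindex φ₀)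
  obtain ⟨e₁, -, h₁⟩ := (realization (X.reindex φ₁).property).exists_iso (R.reindex φ₁)
  have h2 := (h₀.comp (R.compat_reindexHom h)).comp h₁
  have h3 : (indProLim k).map (X.reindexHom h).hom = (e₀.hom ≫ 𝟙 _) ≫ e₁.inv :=
    (compat_map _ _ (X.reindexHom h).hom).unique
      (h2.congr ((Category.comp_id _).trans (Category.id_comp _)))
  rw [h3]
  infer_instance

theorem beilinsonU_isInvertedBy_admLim :
    (beilinsonU (FGModuleCat.{u} k)).IsInvertedBy (admLim (k := k)) := by
  rintro _ _ _ ⟨X, φ₀, φ₁, h⟩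
  have h1 : IsIso ((countableLLCProp k).ι.map (admLim.map (X.reindexHom h))) :=
    indProLim.map_reindexHom h
  exact (countableLLCProp k).fullyFaithfulι.isIso_of_isIso_map _

theorem indProLim.map_injective {X Y : AdmBiFun (FGModuleCat.{u} k)} {f g : X ⟶ Y}
    (h : (indProLim k).map f.hom = (indProLim k).map g.hom) : f = g :=
  ObjectProperty.hom_ext _ ((compat_map X.property Y.property f.hom).injective
    (h ▸ compat_map X.property Y.property g.hom))

/-- The denominator is a `φ` after which `g` respects the filtrations, so that `g` induces `f` on
subquotients. -/
theorem indProLim.exists_map_eq {X Y : AdmBiFun (FGModuleCat.{u} k)}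
    (g : (indProLim k).obj X.obj ⟶ (indProLim k).obj Y.obj) :
    ∃ (φ : Bicofinal) (h : ∀ n, φ.toFun n ≤ n) (f : X.reindex φ ⟶ Y),
      (indProLim k).map f.hom = (indProLim k).map (X.fromReindex φ h).hom ≫ g := by
  let R := realization X.property
  let S := realization Y.property
  obtain ⟨φ, hφ, hg⟩ := R.exists_bicofinal S g
  obtain ⟨f, hf⟩ := (R.reindex φ).exists_hom_compat S g hg
  obtain ⟨e, he, -⟩ := (realization (X.reindex φ).property).exists_iso (R.reindex φ)
  refine ⟨φ, hφ, ObjectProperty.homMk f, ?_⟩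
  have h1 : (indProLim k).map (X.fromReindex φ hφ).hom = e.hom :=
    (compat_map _ _ (X.fromReindex φ hφ).hom).unique
      (((he.comp (R.compat_fromReindex hφ)).congr (Category.id_comp _)) |> fun h => by
        rwa [Category.comp_id] at h)
  rw [h1]
  exact (compat_map (X.reindex φ).property Y.property f).unique
    ((he.comp hf).congr (Category.id_comp _))

/-- The functor from Tate spaces to topological vector spaces. -/
noncomputable def tateLim : TateCat k ⥤ CountableLLCCat k :=
  Localization.Construction.lift admLim beilinsonU_isInvertedBy_admLim

/-- The functor `tateLim` is induced by `indProLim`. -/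
noncomputable def tateLimIso : (beilinsonU (FGModuleCat.{u} k)).Q ⋙ tateLim ≅ admLim :=
  eqToIso (Localization.Construction.fac _ _)

theorem tateLim_map_Q {X Y : AdmBiFun (FGModuleCat.{u} k)} (f : X ⟶ Y) :
    (tateLim.map ((beilinsonU (FGModuleCat.{u} k)).Q.map f)).hom = (indProLim k).map f.hom :=
  rfl

instance : (tateLim (k := k)).EssSurj where
  mem_essImage V := by
    obtain ⟨X, hX, ⟨R⟩⟩ := exists_tateRealization V.obj V.property
    obtain ⟨e, -⟩ := (indProLim.realization hX).exists_iso R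
    exact ⟨(beilinsonU _).Q.obj ⟨X, hX⟩,
      ⟨tateLimIso.app _ ≪≫ (countableLLCProp k).isoMk e⟩⟩

/-- A common denominator reduces faithfulness to that of `indProLim` on admissible functors. -/
theorem tateLim_map_injective {X Y : AdmBiFun (FGModuleCat.{u} k)}
    {a b : (beilinsonU _).Q.obj X ⟶ (beilinsonU _).Q.obj Y}
    (h : (tateLim (k := k)).map a = tateLim.map b) : a = b := by
  obtain ⟨φ, hφ, f, g, hf, hg⟩ := AdmBiFun.exists_roofs a b
  have h1 : f = g := indProLim.map_injective (by
    rw [← tateLim_map_Q, ← tateLim_map_Q, ← hf, ← hg, Functor.map_comp, Functor.map_comp, h])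
  rw [← cancel_epi ((beilinsonU _).Q.map (X.fromReindex φ hφ)), hf, hg, h1]

theorem tateLim_map_surjective {X Y : AdmBiFun (FGModuleCat.{u} k)}
    (g : (tateLim (k := k)).obj ((beilinsonU _).Q.obj X) ⟶ tateLim.obj ((beilinsonU _).Q.obj Y)) :
    ∃ a, tateLim.map a = g := by
  obtain ⟨φ, hφ, f, hf⟩ := indProLim.exists_map_eq (X := X) (Y := Y) g.hom
  refine ⟨inv ((beilinsonU _).Q.map (X.fromReindex φ hφ)) ≫ (beilinsonU _).Q.map f, ?_⟩
  rw [Functor.map_comp, Functor.map_inv, IsIso.inv_comp_eq]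
  refine ObjectProperty.hom_ext _ ?_
  refine (tateLim_map_Q f).trans (hf.trans ?_)
  rw [← tateLim_map_Q]
  rfl

instance : (tateLim (k := k)).Faithful where
  map_injective {A B} _ _ h :=
    tateLim_map_injective (X := (Localization.Construction.objEquiv _).symm A)
      (Y := (Localization.Construction.objEquiv _).symm B) h

instance : (tateLim (k := k)).Full where
  map_surjective {A B} g :=
    tateLim_map_surjective (X := (Localization.Construction.objEquiv _).symm A)
      (Y := (Localization.Construction.objEquiv _).symm B) g

instance : (tateLim (k := k)).IsEquivalence where

end TateFunctorEquivalence

/-! ### Representable ind-objects are finitely presentable -/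

section IndObjects

variable {D : Type u} [Category.{v} D]

/-- Morphisms from a representable ind-object are given by evaluation. -/
noncomputable def Ind.coyonedaYonedaIso (X : D) :
    coyoneda.obj (op (Ind.yoneda.obj X)) ≅
      Ind.inclusion D ⋙ (evaluation Dᵒᵖ (Type v)).obj (op X) :=
  NatIso.ofComponents
    (fun Z => (Ind.inclusion.fullyFaithful.homEquiv.trans
      (((Ind.yonedaCompInclusion.app X).homFromEquiv).trans yonedaEquiv)).toIso)
    (fun {Z Z'} f => by
      ext g
      simp [yonedaEquiv, Functor.FullyFaithful.homEquiv])

theorem Ind.preservesColimitsOfShape_coyoneda (X : D) (J : Type v) [SmallCategory J] [IsFiltered J] :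
    PreservesColimitsOfShape J (coyoneda.obj (op (Ind.yoneda.obj X))) :=
  have : PreservesColimitsOfShape J (Ind.inclusion D) := inferInstance
  preservesColimitsOfShape_of_natIso (Ind.coyonedaYonedaIso X).symm

variable {J : Type v} [SmallCategory J] [IsFiltered J] {G : J ⥤ D} {c : Cocone (G ⋙ Ind.yoneda)}

theorem Ind.exists_fac_of_isColimit (hc : IsColimit c) {X : D} (f : Ind.yoneda.obj X ⟶ c.pt) :
    ∃ (j : J) (a : X ⟶ G.obj j), Ind.yoneda.map a ≫ c.ι.app j = f := by
  have := Ind.preservesColimitsOfShape_coyoneda X J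
  obtain ⟨j, g, hg⟩ := Types.jointly_surjective _
    (isColimitOfPreserves (coyoneda.obj (op (Ind.yoneda.obj X))) hc) f
  obtain ⟨a, rfl⟩ := Ind.yoneda.map_surjective g
  exact ⟨j, a, hg⟩

theorem Ind.exists_eq_of_isColimit (hc : IsColimit c) {X : D} {j : J} {a b : X ⟶ G.obj j}
    (h : Ind.yoneda.map a ≫ c.ι.app j = Ind.yoneda.map b ≫ c.ι.app j) :
    ∃ (i : J) (t : j ⟶ i), a ≫ G.map t = b ≫ G.map t := by
  have := Ind.preservesColimitsOfShape_coyoneda X J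
  obtain ⟨i, t, ht⟩ := (Types.FilteredColimit.isColimit_eq_iff' 
    (isColimitOfPreserves (coyoneda.obj (op (Ind.yoneda.obj X))) hc) (Ind.yoneda.map a)
    (Ind.yoneda.map b)).1 h
  refine ⟨i, t, Ind.yoneda.map_injective ?_⟩
  rw [Functor.map_comp, Functor.map_comp]
  exact ht

end IndObjects

/-! ### Pro-objects and Kan extension along constant objects -/

section ProObjects

variable {C : Type u} [Category.{v} C]

instance : (ProObj.const C).Full :=
  inferInstanceAs (opOp C ⋙ (Ind.yoneda (C := Cᵒᵖ)).op).Full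

instance : (ProObj.const C).Faithful :=
  inferInstanceAs (opOp C ⋙ (Ind.yoneda (C := Cᵒᵖ)).op).Faithful

theorem ProObj.exists_iso_lim (X : ProObj C) :
    ∃ (J : Type v) (_ : SmallCategory J) (_ : IsFiltered J) (F : Jᵒᵖ ⥤ C),
      Nonempty (X ≅ (ProObj.lim C J).obj F) := by
  let P := X.unop.presentation
  exact ⟨P.I, inferInstance, inferInstance, P.F.leftOp,
    ⟨(Ind.colimitPresentationCompYoneda X.unop).op⟩⟩

variable {J : Type v} [SmallCategory J] [IsFiltered J] (F : Jᵒᵖ ⥤ C)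

theorem ProObj.exists_fac {c : C} (f : (ProObj.lim C J).obj F ⟶ (ProObj.const C).obj c) :
    ∃ (j : Jᵒᵖ) (a : F.obj j ⟶ c), (ProObj.cone F).π.app j ≫ (ProObj.const C).map a = f := by
  obtain ⟨j, a, h⟩ := Ind.exists_fac_of_isColimit (colimit.isColimit (F.rightOp ⋙ Ind.yoneda))
    (X := op c) f.unop
  exact ⟨op j, a.unop, Quiver.Hom.unop_inj h⟩

theorem ProObj.exists_eq {c : C} {j : Jᵒᵖ} {a b : F.obj j ⟶ c}
    (h : (ProObj.cone F).π.app j ≫ (ProObj.const C).map a =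
      (ProObj.cone F).π.app j ≫ (ProObj.const C).map b) :
    ∃ (i : Jᵒᵖ) (t : i ⟶ j), F.map t ≫ a = F.map t ≫ b := by
  obtain ⟨i, t, ht⟩ := Ind.exists_eq_of_isColimit (colimit.isColimit (F.rightOp ⋙ Ind.yoneda))
    (X := op c) (a := a.op) (b := b.op) (congrArg Quiver.Hom.unop h)
  exact ⟨op i, t.op, congrArg Quiver.Hom.unop ht⟩

/-- The canonical cone of a pro-object is a limit cone. -/
noncomputable def ProObj.isLimitCone : IsLimit (ProObj.cone F) :=
  (colimit.isColimit (F.rightOp ⋙ Ind.yoneda)).op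

/-- The functor `j ↦ ("lim" F ⟶ F_j)`. -/
noncomputable def ProObj.toStructuredArrow :
    Jᵒᵖ ⥤ StructuredArrow ((ProObj.lim C J).obj F) (ProObj.const C) :=
  F.toStructuredArrow _ _ (fun j => (ProObj.cone F).π.app j) fun f => (ProObj.cone F).w f

/-- A map from a formal limit to a constant object factors through a stage, essentially uniquely.
Limits over the comma category therefore reduce to limits over the index category. -/
instance : (ProObj.toStructuredArrow F).Initial :=
  Functor.initial_of_exists_of_isCofiltered _
    (fun d => by
      obtain ⟨j, a, h⟩ := ProObj.exists_fac F d.hom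
      exact ⟨j, ⟨StructuredArrow.homMk a h⟩⟩)
    (fun {d c} s s' => by
      obtain ⟨i, t, h⟩ := ProObj.exists_eq F (a := s.right) (b := s'.right)
        ((StructuredArrow.w s).trans (StructuredArrow.w s').symm)
      exact ⟨i, t, StructuredArrow.hom_ext _ _ h⟩)

variable {H : Type w} [Category.{w'} H] (L : C ⥤ H)

/-- The comma category need not be small, but it has a small initial index category. -/
theorem ProObj.hasPointwiseRightKanExtension [HasLimitsOfSize.{v, v} H] :
    (ProObj.const C).HasPointwiseRightKanExtension L := fun X => by
  obtain ⟨J, _, _, F, ⟨e⟩⟩ := X.exists_iso_lim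
  rw [Functor.hasPointwiseRightKanExtensionAt_iff_of_iso _ _ e]
  have : HasLimit (toStructuredArrow F ⋙ StructuredArrow.proj _ _ ⋙ L) :=
    inferInstanceAs (HasLimit (F ⋙ L))
  exact Functor.Initial.hasLimit_of_comp (toStructuredArrow F)

/-- A pointwise right Kan extension along `ProObj.const` sends formal limits to limits. -/
noncomputable def ProObj.isLimitOfIsPointwiseRightKanExtension
    {E : (ProObj.const C).RightExtension L} (hE : E.IsPointwiseRightKanExtension) :
    IsLimit ((Cone.postcompose (Functor.whiskerLeft F E.hom)).obj
      (E.left.mapCone (ProObj.cone F))) :=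
  (Functor.Initial.isLimitWhiskerEquiv (toStructuredArrow F) _).symm (hE _)

end ProObjects

/-! ### Strict pro-objects and linearly compact spaces -/

section ProjectiveLimitFunctor

variable {k : Type u} [Field k] [TopologicalSpace k] [DiscreteTopology k]

open discreteFunctor

theorem exists_isProjectiveLimitFunctor : ∃ Λ, IsProjectiveLimitFunctor k Λ := by
  have : HasLimitsOfSize.{u, u} (TopModuleCat.{u} k) := inferInstance
  have := ProObj.hasPointwiseRightKanExtension (discreteFunctor k)
  let E := Functor.RightExtension.mk _
    (Functor.pointwiseRightKanExtensionCounit (ProObj.const _) (discreteFunctor k))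
  have hE : E.IsPointwiseRightKanExtension :=
    Functor.pointwiseRightKanExtensionIsPointwiseRightKanExtension _ _
  have : IsIso E.hom := hE.isIso_hom
  exact ⟨E.left, asIso E.hom, fun J _ _ F =>
    ⟨ProObj.isLimitOfIsPointwiseRightKanExtension F (discreteFunctor k) hE⟩⟩

namespace IsProjectiveLimitFunctor

variable {Λ : ProObj (FGModuleCat.{u} k) ⥤ TopModuleCat.{u} k}

/-- The comparison isomorphism on constant pro-objects. -/
noncomputable def constIso (hΛ : IsProjectiveLimitFunctor k Λ) :
    ProObj.const (FGModuleCat.{u} k) ⋙ Λ ≅ discreteFunctor k := hΛ.choose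

/-- The cone exhibiting the value at a formal limit as a limit of discrete spaces. -/
noncomputable def cone (hΛ : IsProjectiveLimitFunctor k Λ) {J : Type u} [SmallCategory J]
    [IsFiltered J] (F : Jᵒᵖ ⥤ FGModuleCat.{u} k) : Cone (F ⋙ discreteFunctor k) :=
  (Cone.postcompose (Functor.whiskerLeft F hΛ.constIso.hom)).obj (Λ.mapCone (ProObj.cone F))

/-- The cone `hΛ.cone F` is a limit cone. -/
noncomputable def isLimit (hΛ : IsProjectiveLimitFunctor k Λ) {J : Type u} [SmallCategory J]
    [IsFiltered J] (F : Jᵒᵖ ⥤ FGModuleCat.{u} k) : IsLimit (hΛ.cone F) :=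
  (hΛ.choose_spec J F).some

theorem isLinearlyCompact (hΛ : IsProjectiveLimitFunctor k Λ) (X : ProObj (FGModuleCat.{u} k)) :
    IsLinearlyCompact k (Λ.obj X) := by
  obtain ⟨J, _, _, F, ⟨e⟩⟩ := X.exists_iso_lim
  have h : IsLinearlyCompact k (Λ.obj ((ProObj.lim (FGModuleCat.{u} k) J).obj F)) :=
    limit_isLinearlyCompact (hΛ.isLimit F)
  exact h.of_equiv (Λ.mapIso e.symm).toContinuousLinearEquiv

variable (hΛ : IsProjectiveLimitFunctor k Λ)

/-- The linear map induced by a morphism to a constant pro-object. -/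
noncomputable def linearMap {X : ProObj (FGModuleCat.{u} k)} {c : FGModuleCat.{u} k}
    (f : X ⟶ (ProObj.const _).obj c) : Λ.obj X →ₗ[k] c :=
  toLin (Λ.map f ≫ hΛ.constIso.hom.app c)

theorem linearMap_comp {X Y : ProObj (FGModuleCat.{u} k)} {c : FGModuleCat.{u} k} (g : Y ⟶ X)
    (f : X ⟶ (ProObj.const _).obj c) (y : Λ.obj Y) :
    hΛ.linearMap (g ≫ f) y = hΛ.linearMap f ((Λ.map g).hom y) := by
  rw [linearMap, Λ.map_comp, Category.assoc]
  rfl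

theorem linearMap_comp_const {X : ProObj (FGModuleCat.{u} k)} {c d : FGModuleCat.{u} k}
    (f : X ⟶ (ProObj.const _).obj c) (a : c ⟶ d) (x : Λ.obj X) :
    hΛ.linearMap (f ≫ (ProObj.const _).map a) x = a.hom.hom (hΛ.linearMap f x) := by
  have h : Λ.map (f ≫ (ProObj.const _).map a) ≫ hΛ.constIso.hom.app d =
      (Λ.map f ≫ hΛ.constIso.hom.app c) ≫ (discreteFunctor k).map a := by
    rw [Λ.map_comp, Category.assoc, Category.assoc, ← hΛ.constIso.hom.naturality a]
    rfl
  exact congrArg (fun g => toLin g x) h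

section

variable {J : Type u} [SmallCategory J] [IsFiltered J] {F : Jᵒᵖ ⥤ FGModuleCat.{u} k}

theorem linearMap_surjective (hF : ∀ (a b : Jᵒᵖ) (f : a ⟶ b), Epi (F.map f)) (j : Jᵒᵖ) :
    Function.Surjective (hΛ.linearMap ((ProObj.cone F).π.app j)) :=
  limit_surjective (hΛ.isLimit F) (fun f => have := hF _ _ f; FGModuleCat.surjective_of_epi (F.map f)) j

/-- Strictness enters here: two maps from a common stage that agree after the surjective projection
from the limit are equal. -/
theorem linearMap_injective (hF : ∀ (a b : Jᵒᵖ) (f : a ⟶ b), Epi (F.map f))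
    {c : FGModuleCat.{u} k} {f g : (ProObj.lim _ J).obj F ⟶ (ProObj.const _).obj c}
    (h : hΛ.linearMap f = hΛ.linearMap g) : f = g := by
  obtain ⟨i, a, rfl⟩ := ProObj.exists_fac F f
  obtain ⟨j, b, rfl⟩ := ProObj.exists_fac F g
  let s := IsCofiltered.minToLeft i j
  let t := IsCofiltered.minToRight i j
  have hs := (ProObj.cone F).w s
  have ht := (ProObj.cone F).w t
  have h1 : F.map s ≫ a = F.map t ≫ b := FGModuleCat.hom_ext (LinearMap.ext fun y => by
    obtain ⟨x, rfl⟩ := hΛ.linearMap_surjective hF _ y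
    have h2 := congrArg (fun l => l x) h
    rw [← hs, ← ht] at h2
    simp only [Functor.comp_map, Category.assoc, ← Functor.map_comp] at h2
    exact (hΛ.linearMap_comp_const _ _ _).symm.trans (h2.trans (hΛ.linearMap_comp_const _ _ _)))
  rw [← hs, ← ht]
  simp only [Functor.comp_map, Category.assoc, ← Functor.map_comp, h1]
  rfl

/-- The open kernel of `g` contains the kernel of one projection; a linear section of that
projection gives the factorization through its stage. -/
theorem exists_linearMap_eq (hF : ∀ (a b : Jᵒᵖ) (f : a ⟶ b), Epi (F.map f))
    {c : FGModuleCat.{u} k} (g : Λ.obj ((ProObj.lim _ J).obj F) ⟶ (discreteFunctor k).obj c) :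
    ∃ f : (ProObj.lim _ J).obj F ⟶ (ProObj.const _).obj c, hΛ.linearMap f = toLin g := by
  obtain ⟨j, hj⟩ := limit_nhds_of_isCofiltered (hΛ.isLimit F)
    ((isOpen_ker_toLin g).mem_nhds (map_zero (toLin g)))
  obtain ⟨s, hs⟩ := LinearMap.exists_rightInverse_of_surjective _
    (LinearMap.range_eq_top.2 (hΛ.linearMap_surjective hF j))
  refine ⟨(ProObj.cone F).π.app j ≫ (ProObj.const _).map
    (FGModuleCat.ofHom (toLin g ∘ₗ s)), LinearMap.ext fun x => ?_⟩
  refine (hΛ.linearMap_comp_const _ _ _).trans ?_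
  refine (sub_eq_zero.1 ((map_sub (toLin g) x _).symm.trans (hj _ ?_))).symm
  change hΛ.linearMap ((ProObj.cone F).π.app j) _ = 0
  exact (map_sub (hΛ.linearMap ((ProObj.cone F).π.app j)) x _).trans
    (sub_eq_zero.2 (LinearMap.congr_fun hs _).symm)

theorem map_injective_of_strict (hΛ : IsProjectiveLimitFunctor k Λ) (hF : ∀ (a b : Jᵒᵖ) (f : a ⟶ b), Epi (F.map f))
    {Y : ProObj (FGModuleCat.{u} k)} {f g : (ProObj.lim _ J).obj F ⟶ Y}
    (h : Λ.map f = Λ.map g) : f = g := by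
  obtain ⟨I, _, _, G, ⟨(e : Y ≅ (ProObj.cone G).pt)⟩⟩ := Y.exists_iso_lim
  rw [← cancel_mono e.hom]
  refine (ProObj.isLimitCone G).hom_ext fun i => hΛ.linearMap_injective hF (LinearMap.ext fun x => ?_)
  rw [linearMap_comp, linearMap_comp, Λ.map_comp, Λ.map_comp, h]

/-- Writing `Y` as a formal limit of constants, the map is lifted componentwise; faithfulness on
maps to constants makes the lifts a cone. Only the source has to be strict. -/
theorem map_surjective_of_strict (hΛ : IsProjectiveLimitFunctor k Λ) (hF : ∀ (a b : Jᵒᵖ) (f : a ⟶ b), Epi (F.map f))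
    {Y : ProObj (FGModuleCat.{u} k)} (g : Λ.obj ((ProObj.lim _ J).obj F) ⟶ Λ.obj Y) :
    ∃ f, Λ.map f = g := by
  obtain ⟨I, _, _, G, ⟨(e : Y ≅ (ProObj.cone G).pt)⟩⟩ := Y.exists_iso_lim
  choose f hf using fun i => hΛ.exists_linearMap_eq hF (g ≫ Λ.map e.hom ≫ (hΛ.cone G).π.app i)
  let s : Cone (G ⋙ ProObj.const _) :=
    { pt := (ProObj.lim _ J).obj F
      π := { app := f
             naturality := fun a b t => (Category.id_comp _).trans
              (hΛ.linearMap_injective hF (LinearMap.ext fun x => by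
                refine Eq.trans ?_ (hΛ.linearMap_comp_const _ _ _).symm
                rw [hf, hf]
                exact (coneProj_map (hΛ.cone G) t _).symm)) } }
  refine ⟨(ProObj.isLimitCone G).lift s ≫ e.inv, ?_⟩
  rw [Λ.map_comp, ← Functor.mapIso_inv, Iso.comp_inv_eq]
  refine (hΛ.isLimit G).hom_ext fun i => toLin_injective (LinearMap.ext fun x => ?_)
  have h1 := hΛ.linearMap_comp ((ProObj.isLimitCone G).lift s) ((ProObj.cone G).π.app i) x
  rw [(ProObj.isLimitCone G).fac s i] at h1
  exact h1.symm.trans (congrArg (fun l => l x) (hf i))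

end

/-- The functor induced on strict pro-objects. -/
noncomputable def strictFunctor : StrictProVect k ⥤ LinearlyCompactCat k :=
  ObjectProperty.lift _ ((IsStrictPro _).ι ⋙ Λ) fun X => hΛ.isLinearlyCompact X.obj

instance : hΛ.strictFunctor.Faithful where
  map_injective {X Y} f g h := by
    obtain ⟨J, _, _, F, hF, ⟨e⟩⟩ := X.property
    refine ObjectProperty.hom_ext _ ((cancel_epi e.inv).1 (hΛ.map_injective_of_strict hF ?_))
    rw [Λ.map_comp, Λ.map_comp]
    exact congrArg (fun t => Λ.map e.inv ≫ t) (congrArg (fun t => t.hom) h)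

instance : hΛ.strictFunctor.Full where
  map_surjective {X Y} g := by
    obtain ⟨J, _, _, F, hF, ⟨e⟩⟩ := X.property
    let g' : Λ.obj X.obj ⟶ Λ.obj Y.obj := g.hom
    obtain ⟨f, hf⟩ := hΛ.map_surjective_of_strict hF (Λ.map e.inv ≫ g')
    refine ⟨ObjectProperty.homMk (e.hom ≫ f), ObjectProperty.hom_ext _ ?_⟩
    change Λ.map (e.hom ≫ f) = g'
    rw [Λ.map_comp, hf, ← Category.assoc, ← Λ.map_comp, e.hom_inv_id, Λ.map_id, Category.id_comp]

end IsProjectiveLimitFunctor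

section QuotientSystem

variable {V : TopModuleCat.{u} k} {J : Type u} [Preorder J] {U : J → Submodule k V}
  (hU : Antitone U) (hfin : ∀ j, Module.Finite k (V ⧸ U j))

/-- The projective system of quotients by a decreasing family of subspaces. -/
def quotientSystem : Jᵒᵖ ⥤ FGModuleCat.{u} k where
  obj j := ⟨ModuleCat.of k (V ⧸ U j.unop), hfin _⟩
  map f := ObjectProperty.homMk (ModuleCat.ofHom (Submodule.factor (hU (leOfHom f.unop))))
  map_id _ := FGModuleCat.hom_ext (LinearMap.ext fun x => by
    obtain ⟨x, rfl⟩ := Submodule.mkQ_surjective _ x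
    rfl)
  map_comp _ _ := FGModuleCat.hom_ext (LinearMap.ext fun x => by
    obtain ⟨x, rfl⟩ := Submodule.mkQ_surjective _ x
    rfl)

/-- The cone of the projections to the quotients. -/
def quotientCone (hopen : ∀ j, IsOpen (U j : Set V)) :
    Cone (quotientSystem hU hfin ⋙ discreteFunctor k) where
  pt := V
  π :=
    { app := fun j => ofLin (X := V) (E := (quotientSystem hU hfin).obj j) (U j.unop).mkQ
        ((congrArg (fun W : Submodule k V => IsOpen (W : Set V)) (Submodule.ker_mkQ _)).mpr (hopen _))
      naturality := fun _ _ _ => rfl }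

/-- Points are separated because the space is Hausdorff, and compatible families of cosets have a
common point by linear compactness. -/
theorem nonempty_isLimit_quotientCone [IsDirectedOrder J] [Nonempty J]
    (hopen : ∀ j, IsOpen (U j : Set V)) (hV : IsLinearlyCompact k V)
    (hbasis : ∀ N ∈ 𝓝 (0 : V), ∃ j, (U j : Set V) ⊆ N) :
    Nonempty (IsLimit (quotientCone hU hfin hopen)) := by
  have hproj : ∀ (j : Jᵒᵖ) (x : V), coneProj (quotientCone hU hfin hopen) j x = (U j.unop).mkQ x :=
    fun _ _ => rfl
  refine nonempty_isLimit _ (fun x hx => ?_) (fun e he => ?_) fun N hN => ?_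
  · by_contra h
    have := hV.t2
    obtain ⟨j, hj⟩ := hbasis _ (isOpen_compl_singleton.mem_nhds (Ne.symm h))
    exact hj ((Submodule.Quotient.mk_eq_zero (U j)).1 (hx (op j))) rfl
  · choose v hv using fun j : J => (U j).mkQ_surjective (e (op j))
    obtain ⟨x, hx⟩ := hV.exists_sub_mem U hopen v fun S => by
      obtain ⟨m, hm⟩ := S.exists_le
      refine ⟨v m, fun i hi => (Submodule.Quotient.eq (U i)).1 ?_⟩
      have := he (homOfLE (hm i hi)).op
      rw [← hv, ← hv] at this
      exact this
    exact ⟨x, fun j => ((Submodule.Quotient.eq (U j.unop)).2 (hx j.unop)).trans (hv j.unop)⟩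
  · obtain ⟨j, hj⟩ := hbasis N hN
    exact ⟨{op j}, fun y hy => hj ((Submodule.Quotient.mk_eq_zero (U j)).1
      (hy _ (Finset.mem_singleton_self _)))⟩

theorem IsProjectiveLimitFunctor.exists_iso {Λ : ProObj (FGModuleCat.{u} k) ⥤ TopModuleCat.{u} k}
    (hΛ : IsProjectiveLimitFunctor k Λ) [IsDirectedOrder J] [Nonempty J] (hU : Antitone U)
    (hopen : ∀ j, IsOpen (U j : Set V)) (hV : IsLinearlyCompact k V)
    (hbasis : ∀ N ∈ 𝓝 (0 : V), ∃ j, (U j : Set V) ⊆ N) :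
    ∃ F : Jᵒᵖ ⥤ FGModuleCat.{u} k, (∀ (a b : Jᵒᵖ) (f : a ⟶ b), Epi (F.map f)) ∧
      Nonempty (Λ.obj ((ProObj.lim _ J).obj F) ≅ V) := by
  have hfin := fun j => hV.finite_quotient (U j) (hopen j)
  refine ⟨quotientSystem hU hfin, fun a b f => FGModuleCat.epi_of_surjective _ fun x => ?_, ?_⟩
  · obtain ⟨x, rfl⟩ := Submodule.mkQ_surjective _ x
    exact ⟨(U a.unop).mkQ x, rfl⟩
  · obtain ⟨h⟩ := nonempty_isLimit_quotientCone hU hfin hopen hV hbasis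
    exact ⟨(hΛ.isLimit _).conePointUniqueUpToIso h⟩

end QuotientSystem

namespace IsProjectiveLimitFunctor

variable {Λ : ProObj (FGModuleCat.{u} k) ⥤ TopModuleCat.{u} k} (hΛ : IsProjectiveLimitFunctor k Λ)

instance : hΛ.strictFunctor.EssSurj where
  mem_essImage V := by
    have hV : IsLinearlyCompact k V.obj := V.property
    -- All open subspaces, under reverse inclusion, index the system.
    let J := {U : Submodule k V.obj // IsOpen (U : Set V.obj)}ᵒᵈ
    have : Nonempty J := ⟨OrderDual.toDual ⟨⊤, isOpen_univ⟩⟩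
    have : IsDirectedOrder J := ⟨fun a b => ⟨OrderDual.toDual
      ⟨(OrderDual.ofDual a).1 ⊓ (OrderDual.ofDual b).1,
        (OrderDual.ofDual a).2.inter (OrderDual.ofDual b).2⟩, fun _ h => h.1, fun _ h => h.2⟩⟩
    obtain ⟨F, hF, ⟨e⟩⟩ := hΛ.exists_iso (J := J) (U := fun U => (OrderDual.ofDual U).1)
      (fun _ _ h => h) (fun U => (OrderDual.ofDual U).2) hV fun N hN => by
        have := hV.linear
        obtain ⟨U, hU, h⟩ := (IsLinearTopology.hasBasis_open_submodule k).mem_iff.1 hN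
        exact ⟨OrderDual.toDual ⟨U, hU⟩, h⟩
    exact ⟨⟨(ProObj.lim _ J).obj F, J, inferInstance, inferInstance, F, hF, ⟨Iso.refl _⟩⟩,
      ⟨(linearlyCompactProp k).isoMk e⟩⟩

instance : hΛ.strictFunctor.IsEquivalence where

end IsProjectiveLimitFunctor

end ProjectiveLimitFunctor

/-! ### Countable strict pro-objects inside Tate spaces -/

section CountableProObjects

variable {C : Type u} [Category.{v} C] {J : Type v} [SmallCategory J] [IsFiltered J]

theorem ProObj.lim_map_cone_π {F G : Jᵒᵖ ⥤ C} (f : F ⟶ G) (j : Jᵒᵖ) :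
    (ProObj.lim C J).map f ≫ (ProObj.cone G).π.app j =
      (ProObj.cone F).π.app j ≫ (ProObj.const C).map (f.app j) :=
  Quiver.Hom.unop_inj (ι_colimMap (Functor.whiskerRight (NatTrans.rightOp f) Ind.yoneda) j.unop)

variable {k : Type u} [Field k]

theorem IsLinearlyCompact.countableLLC [TopologicalSpace k] {V : TopModuleCat.{u} k}
    (hV : IsLinearlyCompact k V) (hc : (𝓝 (0 : V)).IsCountablyGenerated) :
    countableLLCProp k V := by
  have h : IsOpen ((⊤ : Submodule k V) : Set V) ∧ IsLinearlyCompact k (⊤ : Submodule k V) :=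
    ⟨isOpen_univ, hV.of_equiv Submodule.topContEquiv.symm⟩
  exact ⟨⟨hV.t2, hV.linear, ⊤, h⟩, hc, fun _ => ⊤, fun _ => h, fun _ => ⟨0, trivial⟩⟩

theorem exists_antitone_open_submodule {V : Type*} [AddCommGroup V] [Module k V]
    [TopologicalSpace V] [IsTopologicalAddGroup V] (hlin : IsLinearTopology k V)
    (hc : (𝓝 (0 : V)).IsCountablyGenerated) :
    ∃ W : ℕ → Submodule k V, Antitone W ∧ (∀ n, IsOpen (W n : Set V)) ∧
      ∀ U ∈ 𝓝 (0 : V), ∃ n, (W n : Set V) ⊆ U := by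
  obtain ⟨W, hW, hWU⟩ := exists_seq_open_submodule hlin hc
  refine ⟨fun n => (Finset.range (n + 1)).inf W,
    fun m n h => Finset.inf_mono (by simpa using h), fun n => ?_, fun U hU => ?_⟩
  · exact Finset.inf_induction (p := fun P : Submodule k V => IsOpen (P : Set V)) isOpen_univ
      (fun P hP Q hQ => hP.inter hQ) fun i _ => hW i
  · obtain ⟨n, hn⟩ := hWU U hU
    exact ⟨n, fun x hx => hn ((Finset.inf_le (Finset.self_mem_range_succ n) :
      (Finset.range (n + 1)).inf W ≤ W n) hx)⟩

variable [TopologicalSpace k]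

namespace TateRealization

variable {X : AdmBiFun (FGModuleCat.{u} k)} {V : TopModuleCat.{u} k} (R : TateRealization X.obj V)
  (hX : IsIndConstant _ X)

include hX in
-- The isomorphism from `X_{00} = 0` kills `X_{0,j}` for `j ≥ 0`, so the filtration is constant from
-- step `0` on.
theorem mem_zero_of_isIndConstant (x : V) : x ∈ R.L 0 := by
  obtain ⟨j, hj⟩ := R.exists_mem x
  have hj' : x ∈ R.L (max 0 j) := R.mono (le_max_right _ _) hj
  have h := hX 0 (max 0 j) le_rfl (le_max_left _ _)
  have h0 : ∀ y : X.obj.obj (TateIdx.mk 0 (max 0 j) (le_max_left _ _)), y = 0 := fun y => by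
    obtain ⟨z, rfl⟩ := FGModuleCat.surjective_of_epi
      (X.obj.map (TateIdx.hom le_rfl (le_rfl.trans (le_max_left 0 j)) le_rfl (le_max_left 0 j))) y
    exact (congrArg _ (X.property.eq_zero z)).trans (map_zero _)
  exact (R.proj_eq_zero_iff (TateIdx.mk 0 (max 0 j) (le_max_left _ _)) ⟨x, hj'⟩).1 (h0 _)

/-- The projections `V → X_{-n,0}` of a realization of an ind-constant functor. -/
noncomputable def negProj (n : (ULift.{u} ℕ)ᵒᵖ) : V →ₗ[k] X.obj.obj (negIdx.obj n) :=
  R.proj (negIdx.obj n) ∘ₗ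
    LinearMap.id.codRestrict (R.L 0) (R.mem_zero_of_isIndConstant hX)

theorem ker_negProj (n : (ULift.{u} ℕ)ᵒᵖ) : (R.negProj hX n).ker = R.L (-(n.unop.down : ℤ)) := by
  ext x
  exact R.proj_eq_zero_iff (negIdx.obj n) ⟨x, R.mem_zero_of_isIndConstant hX x⟩

end TateRealization

variable [DiscreteTopology k]

open discreteFunctor

namespace IsProjectiveLimitFunctor

variable {Λ : ProObj (FGModuleCat.{u} k) ⥤ TopModuleCat.{u} k} (hΛ : IsProjectiveLimitFunctor k Λ)

include hΛ in
-- The neighbourhood filter of zero in the limit is an infimum of countably many principal filters.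
theorem countableLLC {X : ProObj (FGModuleCat.{u} k)} (hX : IsCountableStrictPro _ X) :
    countableLLCProp k (Λ.obj X) := by
  refine (hΛ.isLinearlyCompact X).countableLLC ?_
  obtain ⟨J, _, _, _, F, -, ⟨e⟩⟩ := hX
  have : Countable Jᵒᵖ := Countable.of_equiv _ equivToOpposite
  have h : (𝓝 (0 : Λ.obj ((ProObj.lim _ J).obj F))).IsCountablyGenerated :=
    limit_isCountablyGenerated (hΛ.isLimit F)
  let e' := (Λ.mapIso e).toContinuousLinearEquiv
  rw [e'.toHomeomorph.isInducing.nhds_eq_comap]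
  have h0 : e'.toHomeomorph 0 = 0 := map_zero e'
  rw [h0]
  exact Filter.comap.isCountablyGenerated _ _

/-- The functor induced on countable strict pro-objects. -/
noncomputable def countableFunctor : CountableStrictProVect k ⥤ CountableLLCCat k :=
  ObjectProperty.lift _ ((IsCountableStrictPro _).ι ⋙ Λ) fun X => hΛ.countableLLC X.property

instance : (hΛ.countableFunctor ⋙ (countableLLCProp k).ι).Full :=
  inferInstanceAs (ObjectProperty.ιOfLE (isCountableStrictPro_le (FGModuleCat.{u} k)) ⋙
    hΛ.strictFunctor ⋙ (linearlyCompactProp k).ι).Full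

instance : (hΛ.countableFunctor ⋙ (countableLLCProp k).ι).Faithful :=
  inferInstanceAs (ObjectProperty.ιOfLE (isCountableStrictPro_le (FGModuleCat.{u} k)) ⋙
    hΛ.strictFunctor ⋙ (linearlyCompactProp k).ι).Faithful

instance : hΛ.countableFunctor.Full :=
  Functor.Full.of_comp_faithful _ (countableLLCProp k).ι

instance : hΛ.countableFunctor.Faithful :=
  Functor.Faithful.of_comp _ (countableLLCProp k).ι

theorem essImage_countableFunctor (V : CountableLLCCat k) :
    hΛ.countableFunctor.essImage V ↔ IsLinearlyCompact k V.obj := by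
  constructor
  · rintro ⟨X, ⟨e⟩⟩
    exact (hΛ.isLinearlyCompact X.obj).of_equiv
      ((countableLLCProp k).ι.mapIso e).toContinuousLinearEquiv
  · intro hV
    obtain ⟨W, hW, hopen, hbasis⟩ :=
      exists_antitone_open_submodule hV.linear V.property.2.countable_nhds
    obtain ⟨F, hF, ⟨e⟩⟩ := hΛ.exists_iso (J := ULift.{u} ℕ) (U := fun n => W n.down)
      (fun _ _ h => hW h) (fun n => hopen n.down) hV fun N hN => by
        obtain ⟨n, hn⟩ := hbasis N hN
        exact ⟨⟨n⟩, hn⟩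
    exact ⟨⟨(ProObj.lim _ _).obj F, _, inferInstance, inferInstance, inferInstance, F, hF,
      ⟨Iso.refl _⟩⟩, ⟨(countableLLCProp k).isoMk e⟩⟩

end IsProjectiveLimitFunctor

namespace TateRealization

variable {X : AdmBiFun (FGModuleCat.{u} k)} {V : TopModuleCat.{u} k} (R : TateRealization X.obj V)
  (hX : IsIndConstant _ X)

/-- The cone of the projections `V → X_{-n,0}` of a realization of an ind-constant functor. -/
noncomputable def negCone : Cone ((negIdx ⋙ X.obj) ⋙ discreteFunctor k) where
  pt := V
  π :=
    { app := fun n => ofLin (R.negProj hX n)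
        ((congrArg (fun W : Submodule k V => IsOpen (W : Set V)) (R.ker_negProj hX n)).mpr
          (R.isOpen _))
      naturality := fun _ b f => toLin_injective (X := V) (E := X.obj.obj (negIdx.obj b))
        (LinearMap.ext fun x =>
          (R.map_proj (negIdx.map f) ⟨x, R.mem_zero_of_isIndConstant hX x⟩).symm) }

theorem nonempty_isLimit_negCone : Nonempty (IsLimit (R.negCone hX)) := by
  have hker : ∀ (n : (ULift.{u} ℕ)ᵒᵖ) (x : V), coneProj (R.negCone hX) n x = 0 ↔
      x ∈ R.L (-(n.unop.down : ℤ)) := fun n x =>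
    R.proj_eq_zero_iff (negIdx.obj n) ⟨x, R.mem_zero_of_isIndConstant hX x⟩
  refine nonempty_isLimit _ (fun x hx => R.separated x fun j => ?_) (fun e he => ?_) fun U hU => ?_
  · exact R.mono (show -((-j).toNat : ℤ) ≤ j by omega) ((hker (op ⟨(-j).toNat⟩) x).1 (hx _))
  · choose v hv using fun n => R.proj_surjective (negIdx.obj n) (e n)
    have hv' : ∀ n, coneProj (R.negCone hX) n (v n : V) = e n := hv
    have hsub : ∀ {a b : ℕ}, b ≤ a → (v (op ⟨a⟩) : V) - v (op ⟨b⟩) ∈ R.L (-(b : ℤ)) := fun {a b} h => by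
      let f : op (ULift.up.{u} a) ⟶ op (ULift.up.{u} b) := (homOfLE (show ULift.up b ≤ ULift.up a from h)).op
      refine (hker (op ⟨b⟩) _).1 ?_
      refine (map_sub (coneProj (R.negCone hX) (op ⟨b⟩)) (v (op ⟨a⟩) : V) (v (op ⟨b⟩) : V)).trans
        (sub_eq_zero.2 ?_)
      exact (coneProj_map (R.negCone hX) f _).symm.trans
        ((congrArg _ (hv' _)).trans ((he f).trans (hv' _).symm))
    -- The truncation sends every nonnegative index to stage `0`, which is harmless because the
    -- whole space is `L 0`.
    obtain ⟨x, hx⟩ := R.complete (fun i => v (op ⟨(-i).toNat⟩)) fun i i' h => by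
      by_cases hi : 0 ≤ i'
      · exact R.mono hi (R.mem_zero_of_isIndConstant hX _)
      · exact R.mono (show -((-i').toNat : ℤ) ≤ i' by omega) (hsub (by omega))
    refine ⟨x, fun n => ?_⟩
    rw [← hv', ← sub_eq_zero]
    refine (map_sub (coneProj (R.negCone hX) n) x _).symm.trans ((hker n _).2 ?_)
    have := hx (-(n.unop.down : ℤ))
    rwa [neg_neg, Int.toNat_natCast] at this
  · obtain ⟨j, hj⟩ := R.exists_le U hU
    refine ⟨{op ⟨(-j).toNat⟩}, fun y hy => hj (R.mono (show -((-j).toNat : ℤ) ≤ j by omega) ?_)⟩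
    exact (hker _ y).1 (hy _ (Finset.mem_singleton_self _))

end TateRealization

namespace IsProjectiveLimitFunctor

variable {Λ : ProObj (FGModuleCat.{u} k) ⥤ TopModuleCat.{u} k} (hΛ : IsProjectiveLimitFunctor k Λ)

/-- On ind-constant functors the projective limit agrees with `indProLim`. -/
noncomputable def indConstantIso (X : (IsIndConstant (FGModuleCat.{u} k)).FullSubcategory) :
    Λ.obj ((ProObj.lim _ _).obj (negIdx.{u} ⋙ X.obj.obj)) ≅ (indProLim k).obj X.obj.obj :=
  (hΛ.isLimit (negIdx.{u} ⋙ X.obj.obj)).conePointUniqueUpToIso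
    ((indProLim.realization X.obj.property).nonempty_isLimit_negCone X.property).some

theorem indConstantIso_hom_negProj (X : (IsIndConstant (FGModuleCat.{u} k)).FullSubcategory)
    (n : (ULift.{u} ℕ)ᵒᵖ) (x : Λ.obj ((ProObj.lim _ _).obj (negIdx.{u} ⋙ X.obj.obj))) :
    (indProLim.realization X.obj.property).negProj X.property n ((hΛ.indConstantIso X).hom.hom x) =
      hΛ.linearMap ((ProObj.cone _).π.app n) x :=
  congrArg (fun g => toLin (E := X.obj.obj.obj (negIdx.obj n)) g x)
    (IsLimit.conePointUniqueUpToIso_hom_comp (hΛ.isLimit (negIdx.{u} ⋙ X.obj.obj))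
      ((indProLim.realization X.obj.property).nonempty_isLimit_negCone X.property).some n)

/-- Both sides are tested on the projections to the `Y_{-n,0}`, where they become the components of
`f`. -/
theorem indConstantIso_naturality {X Y : (IsIndConstant (FGModuleCat.{u} k)).FullSubcategory}
    (f : X ⟶ Y) :
    Λ.map ((ProObj.lim _ _).map (Functor.whiskerLeft negIdx.{u} f.hom.hom)) ≫
      (hΛ.indConstantIso Y).hom = (hΛ.indConstantIso X).hom ≫ (indProLim k).map f.hom.hom := by
  let R := indProLim.realization X.obj.property
  let S := indProLim.realization Y.obj.property
  refine (S.nonempty_isLimit_negCone Y.property).some.hom_ext fun n =>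
    toLin_injective (LinearMap.ext fun x => ?_)
  have h1 := hΛ.indConstantIso_hom_negProj Y n
    ((Λ.map ((ProObj.lim _ _).map (Functor.whiskerLeft negIdx.{u} f.hom.hom))).hom x)
  refine h1.trans ((hΛ.linearMap_comp _ _ x).symm.trans ((congrArg (fun g => hΛ.linearMap g x)
    (ProObj.lim_map_cone_π (Functor.whiskerLeft negIdx.{u} f.hom.hom) n)).trans ?_))
  refine (hΛ.linearMap_comp_const _ _ _).trans ?_
  obtain ⟨h, h2⟩ := indProLim.compat_map X.obj.property Y.obj.property f.hom.hom (negIdx.obj n)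
    ⟨(hΛ.indConstantIso X).hom.hom x, R.mem_zero_of_isIndConstant X.property _⟩
  refine Eq.trans ?_ h2.symm
  exact congrArg _ (hΛ.indConstantIso_hom_negProj X n x).symm

/-- The two functors from ind-constant admissible functors to topological vector spaces agree. -/
noncomputable def indConstantNatIso :
    indConstantToPro (FGModuleCat.{u} k) ⋙ hΛ.countableFunctor ≅
      (IsIndConstant (FGModuleCat.{u} k)).ι ⋙ admLim :=
  NatIso.ofComponents (fun X => (countableLLCProp k).isoMk (hΛ.indConstantIso X))
    fun f => ObjectProperty.hom_ext _ (hΛ.indConstantIso_naturality f)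

/-- The embedding of countable strict pro-objects into Tate spaces. -/
noncomputable def toTate : CountableStrictProVect k ⥤ TateCat k :=
  hΛ.countableFunctor ⋙ tateLim.inv

/-- `toTate` is a lift of `countableFunctor`. -/
noncomputable def toTateCompIso : hΛ.toTate ⋙ tateLim ≅ hΛ.countableFunctor :=
  Functor.isoWhiskerLeft hΛ.countableFunctor tateLim.asEquivalence.counitIso ≪≫
    Functor.rightUnitor _

instance : hΛ.toTate.Full := inferInstanceAs (hΛ.countableFunctor ⋙ tateLim.inv).Full

instance : hΛ.toTate.Faithful := inferInstanceAs (hΛ.countableFunctor ⋙ tateLim.inv).Faithful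

/-- `toTate` sends the formal limit of an ind-constant functor to that functor. -/
noncomputable def indConstantToProCompToTate :
    indConstantToPro (FGModuleCat.{u} k) ⋙ hΛ.toTate ≅
      (IsIndConstant (FGModuleCat.{u} k)).ι ⋙ (beilinsonU (FGModuleCat.{u} k)).Q :=
  calc indConstantToPro (FGModuleCat.{u} k) ⋙ hΛ.toTate
    _ ≅ ((IsIndConstant (FGModuleCat.{u} k)).ι ⋙ admLim) ⋙ tateLim.inv :=
      Functor.isoWhiskerRight hΛ.indConstantNatIso tateLim.inv
    _ ≅ ((IsIndConstant (FGModuleCat.{u} k)).ι ⋙ (beilinsonU _).Q ⋙ tateLim) ⋙ tateLim.inv :=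
      Functor.isoWhiskerRight (Functor.isoWhiskerLeft _ tateLimIso.symm) tateLim.inv
    _ ≅ (IsIndConstant (FGModuleCat.{u} k)).ι ⋙ (beilinsonU _).Q :=
      Functor.isoWhiskerLeft ((IsIndConstant (FGModuleCat.{u} k)).ι ⋙ (beilinsonU _).Q)
        tateLim.asEquivalence.unitIso.symm ≪≫ Functor.rightUnitor _

end IsProjectiveLimitFunctor

end CountableProObjects

theorem mainTheorem8 (k : Type u) [Field k] [TopologicalSpace k] [DiscreteTopology k] :
    ∃ (Φ : TateCat k ⥤ CountableLLCCat k)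
      (Λ : ProObj (FGModuleCat.{u} k) ⥤ TopModuleCat.{u} k)
      (Φ₀ : StrictProVect k ⥤ LinearlyCompactCat k)
      (E : CountableStrictProVect k ⥤ TateCat k),
      -- `Φ` is induced by `(V_{ij}) ↦ colim_j lim_i V_{ij}` and is an equivalence
      Nonempty ((beilinsonU (FGModuleCat.{u} k)).Q ⋙ Φ ⋙ (countableLLCProp k).ι ≅
        (IsAdmissibleBiFun (FGModuleCat.{u} k)).ι ⋙ indProLim k) ∧
      Φ.IsEquivalence ∧
      -- `Φ₀` is given by `"lim" V_j ↦ lim V_j` and is an equivalence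
      IsProjectiveLimitFunctor k Λ ∧
      Nonempty (Φ₀ ⋙ (linearlyCompactProp k).ι ≅ (IsStrictPro (FGModuleCat.{u} k)).ι ⋙ Λ) ∧
      Φ₀.IsEquivalence ∧
      -- `E` is the embedding of countable strict pro-objects into `𝓣`
      E.Full ∧ E.Faithful ∧
      Nonempty (indConstantToPro (FGModuleCat.{u} k) ⋙ E ≅
        (IsIndConstant (FGModuleCat.{u} k)).ι ⋙ (beilinsonU (FGModuleCat.{u} k)).Q) ∧
      -- the restriction of `Φ` along `E` is `Φ₀`
      Nonempty (E ⋙ Φ ⋙ (countableLLCProp k).ι ≅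
        ObjectProperty.ιOfLE (isCountableStrictPro_le (FGModuleCat.{u} k)) ⋙ Φ₀ ⋙
          (linearlyCompactProp k).ι) ∧
      -- and its essential image consists of the linearly compact spaces
      (∀ V : CountableLLCCat k, (E ⋙ Φ).essImage V ↔ IsLinearlyCompact k V.obj) := by
  obtain ⟨Λ, hΛ⟩ := exists_isProjectiveLimitFunctor (k := k)
  refine ⟨tateLim, Λ, hΛ.strictFunctor, hΛ.toTate,
    ⟨Functor.isoWhiskerRight tateLimIso (countableLLCProp k).ι⟩, inferInstance, hΛ,
    ⟨Iso.refl _⟩, inferInstance, inferInstance, inferInstance, ⟨hΛ.indConstantToProCompToTate⟩,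
    ⟨Functor.isoWhiskerRight hΛ.toTateCompIso (countableLLCProp k).ι⟩, fun V => ?_⟩
  rw [← hΛ.essImage_countableFunctor, Functor.essImage_eq_of_natIso hΛ.toTateCompIso]
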